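/- **Setting.** Let $m\ge 0$ and $\mathrm H=\{h\in C([0,1],\mathbb R^m): h_0=0,\ \dot h\in L^2\}$ with $\|h\|=\|\dot h\|_{L^2}$. Fix finitely many volatility factors $a\in A$, each with a Hurst parameter $H_a\in(0,\tfrac12]$ and a driving component $c(a)\in\{1,\dots,m\}$. Fix $0<\kappa<\tfrac12$ with $\kappa<\min_a H_a$ such that every multi-index $k\in\mathbb N^A$ with $\sum_a k_aH_a>\tfrac12$ satisfies $\sum_a k_a(H_a-\kappa)>\tfrac12+\kappa$. For a $(\tfrac12-\kappa)$-Hölder path $M$ started at $0$ put $\hat M^a_t=\int_0^t\sqrt{2H_a}\,(t-r)^{H_a-1/2}\,dM^{c(a)}_r$, and write $X_{s,t}=X_t-X_s$. A *model* is a path $M:[0,1]\to\mathbb R^m$ with $M_0=0$, together with a family $\mathbf M=(\mathbf M^{k,i}_{s,t})$, $0\le s\le t\le1$, $1\le i\le m$, $\sum_a k_aH_a\le\tfrac12$ (standing for $\int_s^t\prod_a(\hat M^a_{s,r})^{k_a}dM^i_r$), such that $\mathbf M^{0,i}_{s,t}=M^i_{s,t}$, Chen's relation $$\mathbf M^{k,i}_{s,t}=\mathbf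 M^{k,i}_{s,u}+\sum_{j\le k}\Big(\prod_a\tbinom{k_a}{j_a}(\hat M^a_{s,u})^{k_a-j_a}\Big)\mathbf M^{j,i}_{u,t}\qquad(s\le u\le t)$$ holds, and $\|\mathbf M^{k,i}\|:=\sup_{s<t}|\mathbf M^{k,i}_{s,t}|/(t-s)^{\frac12-\kappa+\sum_a k_a(H_a-\kappa)}<\infty$. (For $m=2$ and one factor these are the models of the rough volatility regularity structure; for $A=\{1,\dots,m\}$, $c=\mathrm{id}$, $H_a=\frac12$ they are level-2 rough paths.) The space $\mathcal M$ of models has the metric $\max_{k,i}\|\mathbf M^{k,i}-\mathbf N^{k,i}\|$; the homogeneous norm is $|||\mathbf M|||=\max_{k,i}\|\mathbf M^{k,i}\|^{1/(1+\sum_a k_a)}$; the dilation $\delta_\eta$ multiplies $\mathbf M^{k,i}$ by $\eta^{1+\sum_a k_a}$; the canonical lift $\mathbf h$ of $h\in\mathrm H$ is given by Lebesgue integrals; and $T_h\mathbf M$ is the translation of $\mathbf M$ by $h\in\mathrm H$, which lifts $M\mapsto M+h$ by means of Young integrals. A map $G:\mathcal M\to\mathbb R$ is *continuous linear* if $G(\mathbf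 M)=L(M)$ for a bounded linear functional $L$ on the space $C^{\alpha}$, $\alpha=\frac12-\kappa$, of $\alpha$-Hölder paths started at $0$. It is *continuous quadratic* if it is continuous, bounded on $\{|||\mathbf M|||\le1\}$, and $G(T_k\delta_\eta\mathbf M)=G(\mathbf k)+\eta B(M,k)+\eta^2G(\mathbf M)$ for all $k\in\mathrm H$, $\mathbf M\in\mathcal M$, $\eta\ge0$, with a continuous bilinear $B:C^\alpha\times\mathrm H\to\mathbb R$. **Assumptions.** 1. On a probability space, $\mathbf W$ is a random element of $\mathcal M$ whose underlying path is an $m$-dimensional standard Brownian motion. As $\eta\downarrow0$, $\delta_\eta\mathbf W$ satisfies a large deviation principle in $\mathcal M$ with speed $\eta^2$ and good rate function equal to $\frac12\|h\|^2$ at $\mathbf h$, $h\in\mathrm H$, and $+\infty$ at all other models. 2. $\Phi:[0,1]\times\mathcal M\to C([0,1])$, $(\varepsilon,\mathbf M)\mapsto\Phi^\varepsilon(\mathbf M)$, is continuous; write $\Phi_1(h):=\Phi^0(\mathbf h)(1)$ for $h\in\mathrm H$. A scaling $\bar\varepsilon=\bar\varepsilon(\varepsilon)\ge\varepsilon$ with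 $\bar\varepsilon\to0$ as $\varepsilon\downarrow0$ is given. 3. For $h\in\mathrm H$ there are a continuous linear $G_1^h$, a continuous quadratic $G_2^h$ and a constant $K_2^h\in\mathbb R$, with $(h,\mathbf M)\mapsto G_i^h(\mathbf M)$ continuous, such that $$\Phi^0(T_h\delta_\eta\mathbf M)(1)=\Phi_1(h)+\eta G_1^h(\mathbf M)+\eta^2G_2^h(\mathbf M)+R,\qquad 0<\eta\le1,$$ $$\Phi^\varepsilon(T_h\delta_{\bar\varepsilon}\mathbf M)(1)=\Phi_1(h)+\bar\varepsilon G_1^h(\mathbf M)+\bar\varepsilon^2\big(G_2^h(\mathbf M)+K_2^h\big)+R',\qquad 0<\varepsilon\le1,$$ where, uniformly over bounded $h$ and over bounded $\eta|||\mathbf M|||$, respectively bounded $\bar\varepsilon|||\mathbf M|||$, $|R|\le o(\eta^2)+C\eta^3|||\mathbf M|||^3$ and $|R'|\le o(\bar\varepsilon^2)+C\bar\varepsilon^3|||\mathbf M|||^3$. 4. $x\in\mathbb R$; $h^x$ is the unique minimizer of $\frac12\|h\|^2$ among the $h\in\mathrm H$ with $\Phi_1(h)=x$; the differential $D\Phi_1(h^x):\mathrm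 H\to\mathbb R$ is surjective; and the energy $\Lambda(y)=\inf\{\frac12\|h\|^2:\Phi_1(h)=y\}$ is differentiable at $x$. Identify $D\Phi_1(h^x)$ with an element of $\mathrm H$ and let $$g_1=G_1^{h^x}(\mathbf W),\quad v=\frac{D\Phi_1(h^x)}{\|D\Phi_1(h^x)\|^2},\quad \mathbf V=T_{-g_1v}\mathbf W,\quad \Delta_2=G_2^{h^x}(\mathbf V)+K_2^{h^x}.$$ Thus $\Delta_2$ is the term that depends on $\mathbf V$ and not on $g_1$ in the decomposition $g_2=\Delta_2+g_1\Delta_1+g_1^2\Delta_0$ of the second-order coefficient $g_2=G_2^{h^x}(\mathbf W)+K_2^{h^x}$. **Proposition.** Let $A^x=D^2\Phi_1(h^x)$ (second Fréchet derivative) and $\mathrm H_0=\{h^x\}^\perp\subset\mathrm H$. Then $$\Lambda'(x)\,A^x(k,k)<\|k\|^2\ \text{ for all } k\in\mathrm H_0\setminus\{0\}\quad\Longleftrightarrow\quad \exp\big(\Lambda'(x)\Delta_2\big)\in L^{1+}:=\bigcup_{p>1}L^p .$$ -/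

import Mathlib

open MeasureTheory Filter Topology Set
open scoped ENNReal NNReal

noncomputable section

namespace RobustVol

/-! ### The Volterra (Riemann-Liouville) operator -/

/-- The Volterra operator `f ↦ K ^ H * ḟ` with kernel `K ^ H (s, t) = √(2 H) (t - s) ^ (H - 1 / 2)`,
`0 < s < t`, acting on Hölder paths started at the origin. For `H = 1 / 2` it is the identity. For
`H < 1 / 2` and a path `f`, `f 0 = 0`, that is Hölder of exponent greater than `1 / 2 - H`, the
integral `√(2 H) ∫₀ᵗ (t - r) ^ (H - 1 / 2) df r` is, after integration by parts against
`d (f r - f t)`, the absolutely convergent expression below; for an absolutely continuous `f` it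
is the usual convolution with the derivative of `f`. -/
def volterra (H : ℝ) (f : ℝ → ℝ) (t : ℝ) : ℝ :=
  √(2 * H) * (t ^ (H - 1 / 2) * f t
    + (1 / 2 - H) * ∫ r in (0 : ℝ)..t, (t - r) ^ (H - 3 / 2) * (f t - f r))

theorem volterra_const_mul (H c : ℝ) (f : ℝ → ℝ) (t : ℝ) :
    volterra H (fun r => c * f r) t = c * volterra H f t := by
  have : (fun r => (t - r) ^ (H - 3 / 2) * (c * f t - c * f r))
      = fun r => c * ((t - r) ^ (H - 3 / 2) * (f t - f r)) := by
    funext r; ring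
  simp only [volterra, this, intervalIntegral.integral_const_mul]
  ring

theorem volterra_congr (H : ℝ) {f g : ℝ → ℝ} {t : ℝ} (ht : 0 ≤ t)
    (h : ∀ r, 0 ≤ r → r ≤ t → f r = g r) : volterra H f t = volterra H g t := by
  have e : ∫ r in (0 : ℝ)..t, (t - r) ^ (H - 3 / 2) * (f t - f r)
      = ∫ r in (0 : ℝ)..t, (t - r) ^ (H - 3 / 2) * (g t - g r) := by
    apply intervalIntegral.integral_congr
    intro r hr
    rw [uIcc_of_le ht] at hr
    simp only [h r hr.1 hr.2, h t ht le_rfl]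
  rw [volterra, volterra, e, h t ht le_rfl]

/-- The two forms of the Marchaud integral. -/
theorem volterra_eq {H β C : ℝ} {f : ℝ → ℝ} (hH2 : H < 1 / 2) (hβ : 1 / 2 - H < β)
    (f0 : f 0 = 0)
    (hf : ∀ s t, 0 ≤ s → s ≤ 1 → 0 ≤ t → t ≤ 1 → |f t - f s| ≤ C * |t - s| ^ β)
    {t : ℝ} (ht0 : 0 ≤ t) (ht1 : t ≤ 1) :
    IntervalIntegrable (fun u => u ^ (H - 3 / 2) * (f t - f (max (t - u) 0))) volume 0 1 ∧
    volterra H f t = √(2 * H) * (f t + (1 / 2 - H) *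
      ∫ u in (0 : ℝ)..1, u ^ (H - 3 / 2) * (f t - f (max (t - u) 0))) := by
  have hC : 0 ≤ C := by
    have := hf 0 1 le_rfl zero_le_one zero_le_one le_rfl
    norm_num at this
    exact (abs_nonneg _).trans this
  have hcont : ContinuousOn f (Icc 0 1) := by
    intro s hs
    rw [ContinuousWithinAt, tendsto_iff_dist_tendsto_zero]
    refine squeeze_zero' (g := fun r => C * |r - s| ^ β) ?_ ?_ ?_
    · exact Eventually.of_forall fun _ => dist_nonneg
    · filter_upwards [self_mem_nhdsWithin] with r hr
      rw [Real.dist_eq]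
      exact hf s r hs.1 hs.2 hr.1 hr.2
    · have : Tendsto (fun r : ℝ => C * |r - s| ^ β) (𝓝 s) (𝓝 (C * |s - s| ^ β)) := by
        apply Tendsto.const_mul
        apply Tendsto.rpow_const
        · exact (continuous_abs.tendsto _).comp ((continuous_sub_right s).tendsto s)
        · right; linarith
      rw [sub_self, abs_zero, Real.zero_rpow (by linarith), mul_zero] at this
      exact this.mono_left nhdsWithin_le_nhds
  have hint : IntervalIntegrable (fun u => u ^ (H - 3 / 2) * (f t - f (max (t - u) 0)))
      volume 0 1 := by
    have hdom : IntervalIntegrable (fun u : ℝ => C * u ^ (β + (H - 3 / 2))) volume 0 1 :=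
      (intervalIntegral.intervalIntegrable_rpow' (by linarith)).const_mul C
    refine hdom.mono_fun ?_ ?_
    · rw [uIoc_of_le zero_le_one]
      apply ContinuousOn.aestronglyMeasurable _ measurableSet_Ioc
      apply ContinuousOn.mul
      · intro u hu
        exact (Real.continuousAt_rpow_const u _ (Or.inl hu.1.ne')).continuousWithinAt
      · apply continuousOn_const.sub
        apply hcont.comp (by fun_prop)
        intro u hu
        exact ⟨le_max_right _ _, max_le (by linarith [hu.1]) zero_le_one⟩
    · rw [uIoc_of_le zero_le_one]
      filter_upwards [ae_restrict_mem measurableSet_Ioc] with u hu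
      have hu0 : 0 < u := hu.1
      rw [Real.norm_eq_abs, abs_mul, Real.norm_eq_abs, abs_of_nonneg (Real.rpow_nonneg hu0.le _),
        abs_of_nonneg (mul_nonneg hC (Real.rpow_nonneg hu0.le _)), Real.rpow_add hu0]
      have h1 := hf (max (t - u) 0) t (le_max_right _ _)
        (max_le (by linarith) zero_le_one) ht0 ht1
      have h2 : |t - max (t - u) 0| ≤ u := by
        rw [abs_le]
        constructor
        · rcases max_cases (t - u) 0 with h | h <;> linarith
        · linarith [le_max_left (t - u) 0]
      have h3 : |t - max (t - u) 0| ^ β ≤ u ^ β :=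
        Real.rpow_le_rpow (abs_nonneg _) h2 (by linarith)
      calc u ^ (H - 3 / 2) * |f t - f (max (t - u) 0)|
          ≤ u ^ (H - 3 / 2) * (C * u ^ β) := by
            apply mul_le_mul_of_nonneg_left _ (Real.rpow_nonneg hu0.le _)
            exact h1.trans (mul_le_mul_of_nonneg_left h3 hC)
        _ = _ := by ring
  refine ⟨hint, ?_⟩
  rw [volterra]
  congr 1
  rcases ht0.eq_or_lt with h0 | htpos
  · subst h0
    have : ∀ u ∈ uIcc (0 : ℝ) 1, u ^ (H - 3 / 2) * (f 0 - f (max (0 - u) 0)) = 0 := by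
      intro u hu
      rw [uIcc_of_le zero_le_one] at hu
      rw [max_eq_right (by linarith [hu.1]), sub_self, mul_zero]
    rw [intervalIntegral.integral_congr (g := fun _ => 0) this]
    simp [f0]
  have hsub : ∫ r in (0 : ℝ)..t, (t - r) ^ (H - 3 / 2) * (f t - f r)
      = ∫ u in (0 : ℝ)..t, u ^ (H - 3 / 2) * (f t - f (max (t - u) 0)) := by
    have := intervalIntegral.integral_comp_sub_left
      (fun u => u ^ (H - 3 / 2) * (f t - f (t - u))) t (a := 0) (b := t)
    simp only [sub_sub_cancel, sub_self, sub_zero] at this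
    rw [this]
    apply intervalIntegral.integral_congr
    intro u hu
    rw [uIcc_of_le ht0] at hu
    simp only [max_eq_left (sub_nonneg.2 hu.2)]
  have hsplit := intervalIntegral.integral_add_adjacent_intervals
    (hint.mono_set (a := 0) (b := 1) (c := 0) (d := t) (by
      rw [uIcc_of_le ht0, uIcc_of_le zero_le_one]; exact Icc_subset_Icc le_rfl ht1))
    (hint.mono_set (a := 0) (b := 1) (c := t) (d := 1) (by
      rw [uIcc_of_le ht1, uIcc_of_le zero_le_one]; exact Icc_subset_Icc ht0 le_rfl))
  have htail : ∫ u in t..1, u ^ (H - 3 / 2) * (f t - f (max (t - u) 0))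
      = ((1 - t ^ (H - 1 / 2)) / (H - 1 / 2)) * f t := by
    have e1 : ∫ u in t..1, u ^ (H - 3 / 2) * (f t - f (max (t - u) 0))
        = ∫ u in t..1, u ^ (H - 3 / 2) * f t := by
      apply intervalIntegral.integral_congr
      intro u hu
      rw [uIcc_of_le ht1] at hu
      simp only [max_eq_right (sub_nonpos.2 hu.1), f0, sub_zero]
    rw [e1, intervalIntegral.integral_mul_const, integral_rpow]
    · rw [show H - 3 / 2 + 1 = H - 1 / 2 by ring, Real.one_rpow]
    · right
      refine ⟨by linarith, ?_⟩
      rw [uIcc_of_le ht1]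
      intro h
      linarith [h.1]
  rw [hsub, ← hsplit, htail]
  have e2 : (1 / 2 - H) * ((1 - t ^ (H - 1 / 2)) / (H - 1 / 2)) = t ^ (H - 1 / 2) - 1 := by
    have : H - 1 / 2 ≠ 0 := by linarith
    rw [show (1 : ℝ) / 2 - H = -(H - 1 / 2) by ring, neg_mul, mul_div_cancel₀ _ this]
    ring
  rw [mul_add, ← mul_assoc, e2]
  ring

theorem volterra_holder {H β C : ℝ} {f : ℝ → ℝ} (hH2 : H ≤ 1 / 2)
    (hβ : 1 / 2 - H < β) (f0 : f 0 = 0)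
    (hf : ∀ s t, 0 ≤ s → s ≤ 1 → 0 ≤ t → t ≤ 1 → |f t - f s| ≤ C * |t - s| ^ β) :
    ∃ C', 0 ≤ C' ∧ ∀ s t, 0 ≤ s → s ≤ t → t ≤ 1 →
      |volterra H f t - volterra H f s| ≤ C' * (t - s) ^ (β - (1 / 2 - H)) := by
  have hC : 0 ≤ C := by
    have := hf 0 1 le_rfl zero_le_one zero_le_one le_rfl
    norm_num at this
    exact (abs_nonneg _).trans this
  rcases hH2.eq_or_lt with rfl | hlt
  · refine ⟨C, hC, fun s t hs hst ht => ?_⟩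
    have hv : ∀ r, volterra (1 / 2) f r = f r := by
      intro r; simp [volterra]
    rw [hv, hv]
    have := hf s t hs (hst.trans ht) (hs.trans hst) ht
    rw [abs_of_nonneg (sub_nonneg.2 hst)] at this
    simpa using this
  set γ := 1 / 2 - H with hγ
  have hγ0 : 0 < γ := by linarith
  refine ⟨√(2 * H) * (C + γ * (2 * C / (β - γ) + 2 * C / γ)), ?_, fun s t hs hst ht => ?_⟩
  · have : 0 < β - γ := by linarith
    positivity
  rcases hst.eq_or_lt with rfl | hst'
  · rw [sub_self, abs_zero, sub_self, Real.zero_rpow (by linarith), mul_zero]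
  obtain ⟨is, es⟩ := volterra_eq hlt hβ f0 hf hs (hst.trans ht)
  obtain ⟨it, et⟩ := volterra_eq hlt hβ f0 hf (hs.trans hst) ht
  set δ := t - s with hδ
  have hδ0 : 0 < δ := by linarith
  have hδ1 : δ ≤ 1 := by linarith
  set D : ℝ → ℝ := fun u => u ^ (H - 3 / 2) * (f t - f (max (t - u) 0))
    - u ^ (H - 3 / 2) * (f s - f (max (s - u) 0)) with hD
  have iD : IntervalIntegrable D volume 0 1 := it.sub is
  have hmax : ∀ a b : ℝ, |max a 0 - max b 0| ≤ |a - b| := fun a b => abs_max_sub_max_le_abs a b 0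
  have hmem : ∀ a : ℝ, a ≤ 1 → 0 ≤ max a 0 ∧ max a 0 ≤ 1 :=
    fun a ha => ⟨le_max_right _ _, max_le ha zero_le_one⟩
  have hF : ∀ a b : ℝ, a ≤ 1 → b ≤ 1 → |f (max a 0) - f (max b 0)| ≤ C * |a - b| ^ β := by
    intro a b ha hb
    refine (hf _ _ (hmem b hb).1 (hmem b hb).2 (hmem a ha).1 (hmem a ha).2).trans ?_
    exact mul_le_mul_of_nonneg_left
      (Real.rpow_le_rpow (abs_nonneg _) (hmax a b) (by linarith)) hC
  have hFt : f (max t 0) = f t := by rw [max_eq_left (by linarith)]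
  have hFs : f (max s 0) = f s := by rw [max_eq_left hs]
  have b1 : ∀ u, 0 < u → |D u| ≤ 2 * C * u ^ (β - γ - 1) := by
    intro u hu
    have h1 := hF t (t - u) ht (by linarith)
    have h2 := hF s (s - u) (by linarith) (by linarith)
    rw [hFt, sub_sub_cancel, abs_of_pos hu] at h1
    rw [hFs, sub_sub_cancel, abs_of_pos hu] at h2
    have : D u = u ^ (H - 3 / 2) * ((f t - f (max (t - u) 0)) - (f s - f (max (s - u) 0))) := by
      simp only [hD]; ring
    rw [this, abs_mul, abs_of_nonneg (Real.rpow_nonneg hu.le _),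
      show β - γ - 1 = (H - 3 / 2) + β by rw [hγ]; ring, Real.rpow_add hu]
    have h3 := (abs_sub (f t - f (max (t - u) 0)) (f s - f (max (s - u) 0))).trans (add_le_add h1 h2)
    have := mul_le_mul_of_nonneg_left h3 (Real.rpow_nonneg hu.le (H - 3 / 2))
    linarith
  have b2 : ∀ u, 0 < u → |D u| ≤ 2 * C * δ ^ β * u ^ (H - 3 / 2) := by
    intro u hu
    have h1 := hF t s ht (by linarith)
    have h2 := hF (t - u) (s - u) (by linarith) (by linarith)
    rw [hFt, hFs, ← hδ, abs_of_pos hδ0] at h1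
    rw [sub_sub_sub_cancel_right, ← hδ, abs_of_pos hδ0] at h2
    have : D u = u ^ (H - 3 / 2) * ((f t - f s) - (f (max (t - u) 0) - f (max (s - u) 0))) := by
      simp only [hD]; ring
    rw [this, abs_mul, abs_of_nonneg (Real.rpow_nonneg hu.le _)]
    have h3 := (abs_sub (f t - f s) (f (max (t - u) 0) - f (max (s - u) 0))).trans (add_le_add h1 h2)
    have := mul_le_mul_of_nonneg_left h3 (Real.rpow_nonneg hu.le (H - 3 / 2))
    linarith
  have I1 : |∫ u in (0 : ℝ)..δ, D u| ≤ 2 * C / (β - γ) * δ ^ (β - γ) := by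
    have hg : IntervalIntegrable (fun u : ℝ => 2 * C * u ^ (β - γ - 1)) volume 0 δ :=
      (intervalIntegral.intervalIntegrable_rpow' (by linarith)).const_mul _
    have := intervalIntegral.norm_integral_le_of_norm_le hδ0.le
      (f := D) (g := fun u : ℝ => 2 * C * u ^ (β - γ - 1))
      (Eventually.of_forall fun u hu => b1 u hu.1) hg
    rw [intervalIntegral.integral_const_mul, integral_rpow (Or.inl (by linarith)),
      sub_add_cancel, Real.zero_rpow (by linarith), sub_zero] at this
    refine this.trans (le_of_eq ?_)
    ring
  have I2 : |∫ u in δ..1, D u| ≤ 2 * C / γ * δ ^ (β - γ) := by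
    have h0 : (0 : ℝ) ∉ uIcc δ 1 := by
      rw [uIcc_of_le hδ1]; intro h; linarith [h.1]
    have hg : IntervalIntegrable (fun u : ℝ => 2 * C * δ ^ β * u ^ (H - 3 / 2)) volume δ 1 :=
      (intervalIntegral.intervalIntegrable_rpow (Or.inr h0)).const_mul _
    have := intervalIntegral.norm_integral_le_of_norm_le hδ1
      (f := D) (g := fun u : ℝ => 2 * C * δ ^ β * u ^ (H - 3 / 2))
      (Eventually.of_forall fun u hu => b2 u (hδ0.trans hu.1)) hg
    rw [intervalIntegral.integral_const_mul, integral_rpow (Or.inr ⟨by linarith, h0⟩),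
      show H - 3 / 2 + 1 = -γ by rw [hγ]; ring, Real.one_rpow] at this
    refine this.trans ?_
    have hp : δ ^ (β - γ) = δ ^ β * δ ^ (-γ) := by rw [← Real.rpow_add hδ0]; rfl
    rw [hp]
    have e : 2 * C * δ ^ β * ((1 - δ ^ (-γ)) / -γ) = 2 * C / γ * (δ ^ β * δ ^ (-γ)) - 2 * C * δ ^ β / γ := by
      field_simp
      ring
    rw [e]
    have : 0 ≤ 2 * C * δ ^ β / γ := by positivity
    linarith
  have hsplit := intervalIntegral.integral_add_adjacent_intervals
    (iD.mono_set (a := 0) (b := 1) (c := 0) (d := δ) (by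
      rw [uIcc_of_le hδ0.le, uIcc_of_le zero_le_one]; exact Icc_subset_Icc le_rfl hδ1))
    (iD.mono_set (a := 0) (b := 1) (c := δ) (d := 1) (by
      rw [uIcc_of_le hδ1, uIcc_of_le zero_le_one]; exact Icc_subset_Icc hδ0.le le_rfl))
  have key : volterra H f t - volterra H f s
      = √(2 * H) * ((f t - f s) + γ * ((∫ u in (0 : ℝ)..δ, D u) + ∫ u in δ..1, D u)) := by
    rw [hsplit, hD, intervalIntegral.integral_sub it is, et, es]
    ring
  rw [key, abs_mul, abs_of_nonneg (Real.sqrt_nonneg _), mul_assoc]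
  apply mul_le_mul_of_nonneg_left _ (Real.sqrt_nonneg _)
  have I0 : |f t - f s| ≤ C * δ ^ (β - γ) := by
    have h := hf s t hs (by linarith) (by linarith) ht
    rw [← hδ, abs_of_pos hδ0] at h
    refine h.trans (mul_le_mul_of_nonneg_left ?_ hC)
    exact Real.rpow_le_rpow_of_exponent_ge hδ0 hδ1 (by linarith)
  calc |(f t - f s) + γ * ((∫ u in (0 : ℝ)..δ, D u) + ∫ u in δ..1, D u)|
      ≤ |f t - f s| + γ * (|∫ u in (0 : ℝ)..δ, D u| + |∫ u in δ..1, D u|) := by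
        refine (abs_add_le _ _).trans ?_
        rw [abs_mul, abs_of_pos hγ0]
        gcongr
        exact abs_add_le _ _
    _ ≤ C * δ ^ (β - γ) + γ * (2 * C / (β - γ) * δ ^ (β - γ) + 2 * C / γ * δ ^ (β - γ)) := by
        gcongr
    _ = _ := by ring


/-! ### The noise -/

/-- The data which determine the space of models over an `m`-dimensional noise: finitely many
volatility factors, the factor `a` being the Volterra process with Hurst parameter
`hurst a ∈ (0, 1 / 2]` driven by the component `driver a` of the noise, and a small loss of
regularity `κ > 0`, so small that every product symbol that is left out of the model below (those
with `∑ k a * hurst a > 1 / 2`) has, for the `κ`-reduced exponents too, positive homogeneity.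
* `m = 2`, one factor driven by the first component: the rough volatility regularity structure.
* `factors = m`, `driver = id`, `hurst = 1 / 2`: level-two rough paths over `m`-dimensional noise
  of Hölder exponent `1 / 2 - κ ∈ (1 / 3, 1 / 2)`. -/
structure NoiseSpec (m : ℕ) where
  /-- the number of factors -/
  factors : ℕ
  /-- the component of the noise which drives a factor -/
  driver : Fin factors → Fin m
  /-- the Hurst parameter of a factor -/
  hurst : Fin factors → ℝ
  /-- the loss of regularity -/
  κ : ℝ
  hurst_pos : ∀ a, 0 < hurst a
  hurst_le : ∀ a, hurst a ≤ 1 / 2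
  κ_pos : 0 < κ
  κ_lt_half : κ < 1 / 2
  κ_lt_hurst : ∀ a, κ < hurst a
  gap : ∀ k : Fin factors → ℕ, 1 / 2 < ∑ a, k a * hurst a →
    1 / 2 + κ < ∑ a, k a * (hurst a - κ)

/-- The Cameron-Martin space `H` of paths `h : [0, 1] → ℝᵐ` with `h 0 = 0` and square-integrable
derivative `ḣ`, with norm `‖h‖ = ‖ḣ‖_{L²}`. It is represented isometrically by `ḣ`. -/
abbrev CameronMartin (m : ℕ) : Type :=
  Lp (EuclideanSpace ℝ (Fin m)) 2 (volume.restrict (Icc (0 : ℝ) 1))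

variable {m : ℕ}

namespace CameronMartin

/-- The path `h i t = ∫₀ᵗ ḣ i r dr` itself. -/
def path (h : CameronMartin m) (i : Fin m) (t : ℝ) : ℝ := ∫ r in (0 : ℝ)..t, h r i

/-- The factors `ĥ a = K ^ (hurst a) * ḣ (driver a)` of a Cameron-Martin path. -/
def hat (S : NoiseSpec m) (h : CameronMartin m) (a : Fin S.factors) (t : ℝ) : ℝ :=
  volterra (S.hurst a) (h.path (S.driver a)) t

theorem bound (h : CameronMartin m) {s t : ℝ} (hs : 0 ≤ s) (hst : s ≤ t) (ht : t ≤ 1) :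
    IntervalIntegrable h volume s t ∧ ∫ r in s..t, ‖h r‖ ≤ ‖h‖ * (t - s) ^ (1 / 2 : ℝ) := by
  have hle : volume.restrict (Ioc s t) ≤ volume.restrict (Icc (0 : ℝ) 1) :=
    Measure.restrict_mono (show Ioc s t ⊆ Icc 0 1 from
      fun r hr => ⟨hs.trans hr.1.le, hr.2.trans ht⟩) le_rfl
  have h2 : MemLp h 2 (volume.restrict (Ioc s t)) := (Lp.memLp h).mono_measure hle
  have hint : Integrable h (volume.restrict (Ioc s t)) := h2.integrable one_le_two
  refine ⟨(intervalIntegrable_iff_integrableOn_Ioc_of_le hst).2 hint, ?_⟩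
  rw [intervalIntegral.integral_of_le hst, integral_norm_eq_lintegral_enorm hint.1,
    ← eLpNorm_one_eq_lintegral_enorm]
  have e1 := eLpNorm_le_eLpNorm_mul_rpow_measure_univ (p := 1) (q := 2) one_le_two hint.1
  have e2 : eLpNorm h 2 (volume.restrict (Ioc s t)) ≤ eLpNorm h 2 (volume.restrict (Icc 0 1)) :=
    eLpNorm_mono_measure _ hle
  have e3 := e1.trans (mul_le_mul_left e2 _)
  rw [Measure.restrict_apply_univ, Real.volume_Ioc] at e3
  have hfin : eLpNorm h 2 (volume.restrict (Icc 0 1)) * ENNReal.ofReal (t - s) ^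
      (1 / (1 : ℝ≥0∞).toReal - 1 / (2 : ℝ≥0∞).toReal) ≠ ⊤ := by
    apply ENNReal.mul_ne_top (Lp.memLp h).2.ne
    apply ENNReal.rpow_ne_top_of_nonneg _ ENNReal.ofReal_ne_top
    norm_num
  refine (ENNReal.toReal_mono hfin e3).trans (le_of_eq ?_)
  rw [ENNReal.toReal_mul, Lp.norm_def, ← ENNReal.toReal_rpow,
    ENNReal.toReal_ofReal (sub_nonneg.2 hst)]
  norm_num

theorem bound_mul (h : CameronMartin m) (i : Fin m) {s t : ℝ} (hs : 0 ≤ s) (hst : s ≤ t)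
    (ht : t ≤ 1) {g : ℝ → ℝ} (hg : ContinuousOn g (Icc s t)) {K : ℝ}
    (hK : ∀ r ∈ Icc s t, |g r| ≤ K) :
    IntervalIntegrable (fun r => g r * h r i) volume s t ∧
      |∫ r in s..t, g r * h r i| ≤ K * (‖h‖ * (t - s) ^ (1 / 2 : ℝ)) := by
  obtain ⟨h1, h2⟩ := h.bound hs hst ht
  have hK0 : 0 ≤ K := (abs_nonneg _).trans (hK s ⟨le_rfl, hst⟩)
  have hi : IntervalIntegrable (fun r => h r i) volume s t := by
    rw [intervalIntegrable_iff] at h1 ⊢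
    have h1' : Integrable (fun r => h r) (volume.restrict (uIoc s t)) := h1
    exact ContinuousLinearMap.integrable_comp
      (EuclideanSpace.proj i : EuclideanSpace ℝ (Fin m) →L[ℝ] ℝ) h1'
  refine ⟨hi.continuousOn_mul (by rwa [uIcc_of_le hst]), ?_⟩
  have h3 : ‖∫ r in s..t, g r * h r i‖ ≤ ∫ r in s..t, K * ‖h r‖ := by
    refine intervalIntegral.norm_integral_le_of_norm_le hst ?_ (h1.norm.const_mul K)
    refine Eventually.of_forall fun r hr => ?_
    rw [norm_mul]
    exact mul_le_mul (hK r ⟨hr.1.le, hr.2⟩) (PiLp.norm_apply_le (h r) i) (norm_nonneg _) hK0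
  rw [intervalIntegral.integral_const_mul] at h3
  exact h3.trans (mul_le_mul_of_nonneg_left h2 hK0)

theorem path_sub (h : CameronMartin m) (i : Fin m) {s t : ℝ} (hs : 0 ≤ s) (hst : s ≤ t)
    (ht : t ≤ 1) : h.path i t - h.path i s = ∫ r in s..t, h r i := by
  have key : ∀ a b : ℝ, 0 ≤ a → a ≤ b → b ≤ 1 →
      IntervalIntegrable (fun r => h r i) volume a b := by
    intro a b ha hab hb
    simpa using (h.bound_mul i ha hab hb (g := fun _ => 1) continuousOn_const (K := 1)
      (by simp)).1
  rw [path, path, sub_eq_iff_eq_add, add_comm]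
  exact (intervalIntegral.integral_add_adjacent_intervals
    (key 0 s le_rfl hs (hst.trans ht)) (key s t hs hst ht)).symm

theorem path_holder (h : CameronMartin m) (i : Fin m) {α : ℝ} (hα : α ≤ 1 / 2) {s t : ℝ}
    (hs : 0 ≤ s) (hs1 : s ≤ 1) (ht : 0 ≤ t) (ht1 : t ≤ 1) :
    |h.path i t - h.path i s| ≤ ‖h‖ * |t - s| ^ α := by
  have key : ∀ s t : ℝ, 0 ≤ s → s < t → t ≤ 1 →
      |h.path i t - h.path i s| ≤ ‖h‖ * |t - s| ^ α := by
    intro s t hs hst ht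
    rw [h.path_sub i hs hst.le ht]
    have := (h.bound_mul i hs hst.le ht (g := fun _ => 1) continuousOn_const (K := 1)
      (by simp)).2
    simp only [one_mul] at this
    rw [abs_of_pos (sub_pos.2 hst)]
    exact this.trans (mul_le_mul_of_nonneg_left (Real.rpow_le_rpow_of_exponent_ge
      (by linarith) (by linarith) hα) (norm_nonneg _))
  rcases lt_trichotomy s t with hst | rfl | hst
  · exact key s t hs hst ht1
  · rw [sub_self, abs_zero]
    positivity
  · rw [abs_sub_comm, abs_sub_comm t]
    exact key t s ht hst hs1

theorem hat_holder (S : NoiseSpec m) (h : CameronMartin m) (a : Fin S.factors) :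
    ∃ C, 0 ≤ C ∧ ∀ s t, 0 ≤ s → s ≤ t → t ≤ 1 →
      |h.hat S a t - h.hat S a s| ≤ C * (t - s) ^ (S.hurst a - S.κ) := by
  have := volterra_holder (S.hurst_le a) (β := 1 / 2 - S.κ) (C := ‖h‖)
    (f := h.path (S.driver a)) (by linarith [S.κ_lt_hurst a]) (by simp [path])
    (fun s t hs hs1 ht ht1 => h.path_holder _ (by linarith [S.κ_pos]) hs hs1 ht ht1)
  rwa [show 1 / 2 - S.κ - (1 / 2 - S.hurst a) = S.hurst a - S.κ by ring] at this

theorem hat_continuousOn (S : NoiseSpec m) (h : CameronMartin m) (a : Fin S.factors) :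
    ContinuousOn (h.hat S a) (Icc 0 1) := by
  obtain ⟨C, hC, hb⟩ := h.hat_holder S a
  have hp : 0 < S.hurst a - S.κ := sub_pos.2 (S.κ_lt_hurst a)
  intro s hs
  rw [ContinuousWithinAt, tendsto_iff_dist_tendsto_zero]
  refine squeeze_zero' (g := fun r => C * |r - s| ^ (S.hurst a - S.κ)) ?_ ?_ ?_
  · exact Eventually.of_forall fun _ => dist_nonneg
  · filter_upwards [self_mem_nhdsWithin] with r hr
    rw [Real.dist_eq]
    rcases le_total s r with hsr | hsr
    · rw [abs_of_nonneg (sub_nonneg.2 hsr)]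
      exact hb s r hs.1 hsr hr.2
    · rw [abs_sub_comm, abs_sub_comm r, abs_of_nonneg (sub_nonneg.2 hsr)]
      exact hb r s hr.1 hsr hs.2
  · have : Tendsto (fun r : ℝ => C * |r - s| ^ (S.hurst a - S.κ)) (𝓝 s)
        (𝓝 (C * |s - s| ^ (S.hurst a - S.κ))) := by
      apply Tendsto.const_mul
      apply Tendsto.rpow_const
      · exact (continuous_abs.tendsto _).comp ((continuous_sub_right s).tendsto s)
      · right; exact hp.le
    rw [sub_self, abs_zero, Real.zero_rpow hp.ne', mul_zero] at this
    exact this.mono_left nhdsWithin_le_nhds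

end CameronMartin

namespace NoiseSpec
variable (S : NoiseSpec m)

/-- The multi-indices `k` for which `∫ ∏ₐ (Ŵ a) ^ (k a) dW i` belongs to the model. For a single
factor these are `k = 0, …, M`, with `M` the smallest integer such that `(M + 1) H > 1 / 2`. -/
def Admissible (k : Fin S.factors → ℕ) : Prop := ∑ a, k a * S.hurst a ≤ 1 / 2

/-- The Hölder exponent `1 / 2 - κ + ∑ₐ k a (hurst a - κ)` of `∫ ∏ₐ (Ŵ a) ^ (k a) dW i`. -/
def hom (k : Fin S.factors → ℕ) : ℝ := 1 / 2 - S.κ + ∑ a, k a * (S.hurst a - S.κ)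

/-- The number of occurrences of the noise in `∫ ∏ₐ (Ŵ a) ^ (k a) dW i`. -/
def degree (k : Fin S.factors → ℕ) : ℕ := ∑ a, k a + 1

/-- The coefficients `∏ₐ (k a choose j a) (x a) ^ (k a - j a)` of the expansion of
`∏ₐ (x a + y a) ^ (k a)` in powers of `y`. -/
def coeff (x : Fin S.factors → ℝ) (k j : Fin S.factors → ℕ) : ℝ :=
  ∏ a, ((k a).choose (j a) : ℝ) * x a ^ (k a - j a)

variable {S}

theorem hom_pos (k : Fin S.factors → ℕ) : 0 < S.hom k := by
  have : 0 ≤ ∑ a, (k a : ℝ) * (S.hurst a - S.κ) :=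
    Finset.sum_nonneg fun a _ => mul_nonneg (Nat.cast_nonneg _) (sub_pos.2 (S.κ_lt_hurst a)).le
  have := S.κ_lt_half
  unfold hom
  linarith

theorem admissible_zero : S.Admissible 0 := by simp [Admissible]

theorem Admissible.of_le {k j : Fin S.factors → ℕ} (hk : S.Admissible k) (hj : j ≤ k) :
    S.Admissible j := by
  refine le_trans (Finset.sum_le_sum fun a _ => ?_) hk
  exact mul_le_mul_of_nonneg_right (by exact_mod_cast hj a) (S.hurst_pos a).le

theorem degree_le {k : Fin S.factors → ℕ} (hk : S.Admissible k) :
    S.degree k ≤ ⌊1 / (2 * S.κ)⌋₊ + 1 := by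
  have h1 : (∑ a, (k a : ℝ)) * S.κ ≤ 1 / 2 := by
    rw [Finset.sum_mul]
    refine le_trans (Finset.sum_le_sum fun a _ => ?_) hk
    exact mul_le_mul_of_nonneg_left (S.κ_lt_hurst a).le (Nat.cast_nonneg _)
  have h2 : ((∑ a, k a : ℕ) : ℝ) ≤ 1 / (2 * S.κ) := by
    rw [le_div_iff₀ (by linarith [S.κ_pos])]
    push_cast
    linarith
  exact Nat.add_le_add_right (Nat.le_floor h2) 1

theorem prod_add_pow (x y : Fin S.factors → ℝ) (k : Fin S.factors → ℕ) :
    ∏ a, (x a + y a) ^ k a = ∑ j ∈ Finset.Iic k, S.coeff x k j * ∏ a, y a ^ j a := by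
  have h1 : ∀ a, (x a + y a) ^ k a
      = ∑ l ∈ Finset.Iic (k a), ((k a).choose l : ℝ) * x a ^ (k a - l) * y a ^ l := by
    intro a
    rw [add_comm, add_pow]
    have : Finset.range (k a + 1) = Finset.Iic (k a) := by ext; simp
    rw [this]
    exact Finset.sum_congr rfl fun l _ => by ring
  simp_rw [h1]
  rw [Finset.prod_univ_sum]
  have h2 : Fintype.piFinset (fun a => Finset.Iic (k a)) = Finset.Iic k := by
    ext j; simp [Pi.le_def]
  rw [h2]
  refine Finset.sum_congr rfl fun j _ => ?_
  rw [coeff, ← Finset.prod_mul_distrib]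

end NoiseSpec

variable {S : NoiseSpec m}

/-- The factors `K ^ (hurst a) * Ẇ (driver a)`, computed from the first-level path
`r ↦ X 0 i 0 r` of a family of iterated integrals `X`. -/
def hatOf (S : NoiseSpec m) (X : (Fin S.factors → ℕ) → Fin m → ℝ → ℝ → ℝ) (a : Fin S.factors)
    (t : ℝ) : ℝ := volterra (S.hurst a) (fun r => X 0 (S.driver a) 0 r) t

/-- The space of models: `iter k i s t` is the (a priori given) value of the iterated integral
`∫ₛᵗ ∏ₐ (Ŵ a r - Ŵ a s) ^ (k a) dW i r`, for admissible `k` and `0 ≤ s ≤ t ≤ 1` (it is set to `0`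
otherwise), in particular `iter 0 i s t` is the increment of the `i`-th component of the noise. The
algebraic constraint is Chen's relation; the analytic constraint is the Hölder type bound with the
exponent `hom k` of each symbol. -/
@[ext]
structure Model (S : NoiseSpec m) where
  /-- the iterated integrals -/
  iter : (Fin S.factors → ℕ) → Fin m → ℝ → ℝ → ℝ
  support : ∀ k i s t, ¬ (S.Admissible k ∧ 0 ≤ s ∧ s ≤ t ∧ t ≤ 1) → iter k i s t = 0
  chen : ∀ k i s u t, S.Admissible k → 0 ≤ s → s ≤ u → u ≤ t → t ≤ 1 →
    iter k i s t = iter k i s u + ∑ j ∈ Finset.Iic k,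
      S.coeff (fun a => hatOf S iter a u - hatOf S iter a s) k j * iter j i u t
  bound : ∃ C, ∀ k i s t, S.Admissible k → 0 ≤ s → s ≤ t → t ≤ 1 →
    |iter k i s t| ≤ C * (t - s) ^ S.hom k

namespace Model

/-- The factors of a model. -/
def hat (M : Model S) (a : Fin S.factors) (t : ℝ) : ℝ := hatOf S M.iter a t

/-- The components of the underlying noise path. -/
def comp (M : Model S) (i : Fin m) (t : ℝ) : ℝ := M.iter 0 i 0 t

/-- The difference quotients whose supremum is the model norm. -/
def ratio (M : Model S) (p : (Fin S.factors → ℕ) × Fin m × ℝ × ℝ) : ℝ :=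
  M.iter p.1 p.2.1 p.2.2.1 p.2.2.2 / (p.2.2.2 - p.2.2.1) ^ S.hom p.1

theorem ratio_bdd (M : Model S) : BddAbove (range fun p => ‖M.ratio p‖) := by
  obtain ⟨C, hC⟩ := M.bound
  refine ⟨max C 0, ?_⟩
  rintro _ ⟨⟨k, i, s, t⟩, rfl⟩
  simp only [ratio, norm_div, Real.norm_eq_abs]
  by_cases hd : S.Admissible k ∧ 0 ≤ s ∧ s ≤ t ∧ t ≤ 1
  · obtain ⟨hk, hs, hst, ht⟩ := hd
    have h0 : 0 ≤ (t - s) ^ S.hom k := Real.rpow_nonneg (sub_nonneg.2 hst) _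
    rw [abs_of_nonneg h0]
    apply div_le_of_le_mul₀ h0 (le_max_right _ _)
    exact (hC k i s t hk hs hst ht).trans (mul_le_mul_of_nonneg_right (le_max_left _ _) h0)
  · rw [M.support k i s t hd]
    simp

/-- The difference quotients as a bounded family. -/
def toLp (M : Model S) : lp (fun _ : (Fin S.factors → ℕ) × Fin m × ℝ × ℝ => ℝ) ∞ :=
  ⟨M.ratio, memℓp_infty M.ratio_bdd⟩

theorem toLp_injective : Function.Injective (toLp (S := S)) := by
  intro M N h
  ext k i s t
  by_cases hd : S.Admissible k ∧ 0 ≤ s ∧ s ≤ t ∧ t ≤ 1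
  · obtain ⟨hk, hs, hst, ht⟩ := hd
    rcases hst.eq_or_lt with rfl | hlt
    · have key : ∀ M : Model S, M.iter k i s s = 0 := by
        intro M
        obtain ⟨C, hC⟩ := M.bound
        have := hC k i s s hk hs le_rfl ht
        rw [sub_self, Real.zero_rpow (NoiseSpec.hom_pos k).ne', mul_zero] at this
        exact abs_eq_zero.1 (le_antisymm this (abs_nonneg _))
      rw [key, key]
    · have h1 : M.ratio (k, i, s, t) = N.ratio (k, i, s, t) :=
        congrFun (congrArg Subtype.val h) (k, i, s, t)
      have h2 : (t - s) ^ S.hom k ≠ 0 := (Real.rpow_pos_of_pos (sub_pos.2 hlt) _).ne'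
      simpa only [ratio, div_left_inj' h2] using h1
  · rw [M.support k i s t hd, N.support k i s t hd]

/-- The model metric `‖M - N‖`: the largest of the Hölder type norms
`sup_{s < t} |M.iter k i s t - N.iter k i s t| / (t - s) ^ hom k`. -/
instance : MetricSpace (Model S) := MetricSpace.induced toLp toLp_injective inferInstance

instance : MeasurableSpace (Model S) := borel _

instance : BorelSpace (Model S) := ⟨rfl⟩

/-- The homogeneous model norm `|||M|||`: the largest of the numbers `‖M.iter k i‖ ^ (1 / degree k)`,
with the Hölder type norms of the model metric. -/
def homNorm (M : Model S) : ℝ :=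
  ⨆ p : (Fin S.factors → ℕ) × Fin m × ℝ × ℝ, |M.ratio p| ^ (1 / (S.degree p.1 : ℝ))

/-- The dilation `δ_η` of models: each occurrence of the noise is multiplied by `η`. -/
def dilate (η : ℝ) (M : Model S) : Model S where
  iter k i s t := η ^ S.degree k * M.iter k i s t
  support k i s t h := by rw [M.support k i s t h, mul_zero]
  chen k i s u t hk hs hsu hut ht := by
    have hh : ∀ a r, hatOf S (fun k i s t => η ^ S.degree k * M.iter k i s t) a r
        = η * hatOf S M.iter a r := by
      intro a r
      simp only [hatOf, NoiseSpec.degree, Pi.zero_apply, Finset.sum_const_zero, zero_add, pow_one,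
        volterra_const_mul]
    simp only [hh, M.chen k i s u t hk hs hsu hut ht, mul_add, Finset.mul_sum]
    congr 1
    refine Finset.sum_congr rfl fun j hj => ?_
    have hj' : j ≤ k := Finset.mem_Iic.1 hj
    simp only [NoiseSpec.coeff, ← mul_sub, mul_pow, Finset.prod_mul_distrib,
      Finset.prod_pow_eq_pow_sum]
    have : S.degree k = (∑ a, (k a - j a)) + S.degree j := by
      simp only [NoiseSpec.degree, ← add_assoc, ← Finset.sum_add_distrib]
      congr 1
      exact Finset.sum_congr rfl fun a _ => (Nat.sub_add_cancel (hj' a)).symm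
    rw [this, pow_add]
    ring
  bound := by
    obtain ⟨C, hC⟩ := M.bound
    refine ⟨max 1 |η| ^ (⌊1 / (2 * S.κ)⌋₊ + 1) * max C 0, fun k i s t hk hs hst ht => ?_⟩
    have h1 : |η| ^ S.degree k ≤ max 1 |η| ^ (⌊1 / (2 * S.κ)⌋₊ + 1) :=
      (pow_le_pow_left₀ (abs_nonneg _) (le_max_right _ _) _).trans
        (pow_le_pow_right₀ (le_max_left _ _) (NoiseSpec.degree_le hk))
    have h0 : 0 ≤ (t - s) ^ S.hom k := Real.rpow_nonneg (sub_nonneg.2 hst) _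
    have h2 : |M.iter k i s t| ≤ max C 0 * (t - s) ^ S.hom k :=
      (hC k i s t hk hs hst ht).trans (mul_le_mul_of_nonneg_right (le_max_left _ _) h0)
    rw [abs_mul, abs_pow, mul_assoc]
    exact mul_le_mul h1 h2 (abs_nonneg _) (by positivity)

open Classical in
/-- The iterated integrals `∫ₛᵗ ∏ₐ (ĥ a r - ĥ a s) ^ (k a) dh i r` of a Cameron-Martin path. -/
def liftIter (S : NoiseSpec m) (h : CameronMartin m) (k : Fin S.factors → ℕ) (i : Fin m)
    (s t : ℝ) : ℝ :=
  if S.Admissible k ∧ 0 ≤ s ∧ s ≤ t ∧ t ≤ 1 then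
    ∫ r in s..t, (∏ a, (h.hat S a r - h.hat S a s) ^ k a) * h r i
  else 0

theorem liftIter_of (h : CameronMartin m) {k : Fin S.factors → ℕ} {i : Fin m} {s t : ℝ}
    (hk : S.Admissible k) (hs : 0 ≤ s) (hst : s ≤ t) (ht : t ≤ 1) : liftIter S h k i s t
      = ∫ r in s..t, (∏ a, (h.hat S a r - h.hat S a s) ^ k a) * h r i :=
  if_pos ⟨hk, hs, hst, ht⟩

theorem hatOf_liftIter (h : CameronMartin m) (a : Fin S.factors) {t : ℝ} (ht : 0 ≤ t)
    (ht1 : t ≤ 1) : hatOf S (liftIter S h) a t = h.hat S a t := by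
  refine volterra_congr _ ht fun r hr hrt => ?_
  rw [liftIter_of h NoiseSpec.admissible_zero le_rfl hr (hrt.trans ht1)]
  simp [CameronMartin.path]

theorem prod_continuousOn (h : CameronMartin m) (x : Fin S.factors → ℝ) (k : Fin S.factors → ℕ)
    {s t : ℝ} (hs : 0 ≤ s) (ht : t ≤ 1) :
    ContinuousOn (fun r => ∏ a, (h.hat S a r - x a) ^ k a) (Icc s t) := by
  refine continuousOn_finsetProd _ fun a _ => ?_
  exact (((h.hat_continuousOn S a).mono (Icc_subset_Icc hs ht)).sub continuousOn_const).pow _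

theorem prod_integrable (h : CameronMartin m) (x : Fin S.factors → ℝ) (k : Fin S.factors → ℕ)
    (i : Fin m) {s t : ℝ} (hs : 0 ≤ s) (hst : s ≤ t) (ht : t ≤ 1) :
    IntervalIntegrable (fun r => (∏ a, (h.hat S a r - x a) ^ k a) * h r i) volume s t := by
  have hc := prod_continuousOn h x k hs ht
  obtain ⟨K, hK⟩ := isCompact_Icc.exists_bound_of_continuousOn hc
  exact (h.bound_mul i hs hst ht hc hK).1

/-- The canonical lift of a Cameron-Martin path to a model. -/
def lift (S : NoiseSpec m) (h : CameronMartin m) : Model S where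
  iter := liftIter S h
  support k i s t hd := if_neg hd
  chen k i s u t hk hs hsu hut ht := by
    have hu0 : 0 ≤ u := hs.trans hsu
    have hu1 : u ≤ 1 := hut.trans ht
    have hs1 : s ≤ 1 := hsu.trans hu1
    rw [liftIter_of h hk hs (hsu.trans hut) ht, liftIter_of h hk hs hsu hu1,
      ← intervalIntegral.integral_add_adjacent_intervals
        (prod_integrable h (fun a => h.hat S a s) k i hs hsu hu1)
        ((prod_integrable h (fun a => h.hat S a s) k i hs (hsu.trans hut) ht).mono_set (by
          rw [uIcc_of_le hut, uIcc_of_le (hsu.trans hut)]; exact Icc_subset_Icc hsu le_rfl))]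
    congr 1
    have e1 : ∀ r, (∏ a, (h.hat S a r - h.hat S a s) ^ k a) * h r i
        = ∑ j ∈ Finset.Iic k, S.coeff (fun a => h.hat S a u - h.hat S a s) k j *
          ((∏ a, (h.hat S a r - h.hat S a u) ^ j a) * h r i) := by
      intro r
      have := NoiseSpec.prod_add_pow (S := S) (fun a => h.hat S a u - h.hat S a s)
        (fun a => h.hat S a r - h.hat S a u) k
      simp only [sub_add_sub_cancel'] at this
      rw [this, Finset.sum_mul]
      exact Finset.sum_congr rfl fun j _ => by ring
    simp_rw [e1]
    rw [intervalIntegral.integral_finsetSum fun j _ =>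
      (prod_integrable h (fun a => h.hat S a u) j i hu0 hut ht).const_mul _]
    refine Finset.sum_congr rfl fun j hj => ?_
    rw [intervalIntegral.integral_const_mul,
      liftIter_of h (hk.of_le (Finset.mem_Iic.1 hj)) hu0 hut ht]
    simp only [hatOf_liftIter h _ hu0 hu1, hatOf_liftIter h _ hs hs1]
  bound := by
    choose C hC0 hC using fun a => h.hat_holder S a
    set D : ℝ := 1 + ∑ a, C a with hD
    have hCD : ∀ a, C a ≤ D := fun a => by
      have := Finset.single_le_sum (f := C) (fun b _ => hC0 b) (Finset.mem_univ a)
      linarith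
    have hD1 : 1 ≤ D := by
      have := Finset.sum_nonneg (s := Finset.univ) (f := C) fun b _ => hC0 b
      linarith
    refine ⟨D ^ (⌊1 / (2 * S.κ)⌋₊ + 1) * ‖h‖, fun k i s t hk hs hst ht => ?_⟩
    rw [liftIter_of h hk hs hst ht]
    rcases hst.eq_or_lt with rfl | hlt
    · rw [intervalIntegral.integral_same, abs_zero, sub_self,
        Real.zero_rpow (NoiseSpec.hom_pos k).ne', mul_zero]
    have hp : ∀ r ∈ Icc s t, |∏ a, (h.hat S a r - h.hat S a s) ^ k a|
        ≤ D ^ (⌊1 / (2 * S.κ)⌋₊ + 1) * (t - s) ^ (∑ a, k a * (S.hurst a - S.κ)) := by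
      intro r hr
      rw [Finset.abs_prod]
      have h1 : ∀ a, |(h.hat S a r - h.hat S a s) ^ k a|
          ≤ D ^ k a * (t - s) ^ (k a * (S.hurst a - S.κ)) := by
        intro a
        rw [abs_pow, mul_comm (k a : ℝ), Real.rpow_mul (by linarith), Real.rpow_natCast,
          ← mul_pow]
        refine pow_le_pow_left₀ (abs_nonneg _) ((hC a s r hs hr.1 (hr.2.trans ht)).trans ?_) _
        refine mul_le_mul (hCD a) (Real.rpow_le_rpow (by linarith [hr.1]) (by linarith [hr.2])
          (sub_pos.2 (S.κ_lt_hurst a)).le) (Real.rpow_nonneg (by linarith [hr.1]) _) (by linarith)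
      refine (Finset.prod_le_prod (fun _ _ => abs_nonneg _) fun a _ => h1 a).trans ?_
      rw [Finset.prod_mul_distrib, Finset.prod_pow_eq_pow_sum,
        ← Real.rpow_sum_of_pos (sub_pos.2 hlt)]
      refine mul_le_mul_of_nonneg_right (pow_le_pow_right₀ hD1 ?_)
        (Real.rpow_nonneg (by linarith) _)
      exact (Nat.le_succ _).trans (NoiseSpec.degree_le hk)
    refine (h.bound_mul i hs hst ht (prod_continuousOn h _ k hs ht) hp).2.trans ?_
    have h2 : (t - s) ^ (1 / 2 : ℝ) ≤ (t - s) ^ (1 / 2 - S.κ) :=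
      Real.rpow_le_rpow_of_exponent_ge (sub_pos.2 hlt) (by linarith) (by linarith [S.κ_pos])
    have h3 : (t - s) ^ S.hom k
        = (t - s) ^ (1 / 2 - S.κ) * (t - s) ^ (∑ a, k a * (S.hurst a - S.κ)) :=
      Real.rpow_add (sub_pos.2 hlt) _ _
    rw [h3]
    have h4 := mul_le_mul_of_nonneg_left h2 (show 0 ≤ D ^ (⌊1 / (2 * S.κ)⌋₊ + 1) *
      (t - s) ^ (∑ a, k a * (S.hurst a - S.κ)) * ‖h‖ from by
        have := Real.rpow_nonneg (sub_nonneg.2 hst) (∑ a, k a * (S.hurst a - S.κ))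
        positivity)
    linarith

end Model

/-! ### The path space -/

/-- Paths `[0, 1] → ℝᵐ` started at the origin which are Hölder of exponent `1 / 2 - κ`. -/
def holderSubmodule (S : NoiseSpec m) :
    Submodule ℝ (unitInterval → EuclideanSpace ℝ (Fin m)) where
  carrier := {f | f 0 = 0 ∧ ∃ C, ∀ s t, ‖f t - f s‖ ≤ C * |(t : ℝ) - s| ^ (1 / 2 - S.κ)}
  zero_mem' := ⟨rfl, 0, by simp⟩
  add_mem' := by
    rintro f g ⟨f0, C, hC⟩ ⟨g0, D, hD⟩
    refine ⟨by simp [f0, g0], C + D, fun s t => ?_⟩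
    rw [Pi.add_apply, Pi.add_apply, add_sub_add_comm, add_mul]
    exact (norm_add_le _ _).trans (add_le_add (hC s t) (hD s t))
  smul_mem' := by
    rintro c f ⟨f0, C, hC⟩
    refine ⟨by simp [f0], ‖c‖ * C, fun s t => ?_⟩
    rw [Pi.smul_apply, Pi.smul_apply, ← smul_sub, norm_smul, mul_assoc]
    exact mul_le_mul_of_nonneg_left (hC s t) (norm_nonneg _)

/-- The space `C ^ α`, `α = 1 / 2 - κ`, of `α`-Hölder paths `[0, 1] → ℝᵐ` started at the origin. It
is normed by the Hölder norm `sup_{s ≠ t} |f t - f s| / |t - s| ^ α`. -/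
def HolderPath (S : NoiseSpec m) : Type := holderSubmodule S

namespace HolderPath

instance : AddCommGroup (HolderPath S) := inferInstanceAs (AddCommGroup (holderSubmodule S))
instance : Module ℝ (HolderPath S) := inferInstanceAs (Module ℝ (holderSubmodule S))

/-- The difference quotients whose supremum is the Hölder norm. -/
def quotient (f : HolderPath S) (p : unitInterval × unitInterval) : EuclideanSpace ℝ (Fin m) :=
  (|(p.2 : ℝ) - p.1| ^ (1 / 2 - S.κ))⁻¹ • (f.1 p.2 - f.1 p.1)

/-- The difference quotients as a bounded family. -/
def toLp (S : NoiseSpec m) : HolderPath S →ₗ[ℝ]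
    lp (fun _ : unitInterval × unitInterval => EuclideanSpace ℝ (Fin m)) ∞ where
  toFun f := ⟨f.quotient, memℓp_infty (by
    obtain ⟨-, C, hC⟩ := f.2
    refine ⟨max C 0, ?_⟩
    rintro _ ⟨p, rfl⟩
    have h0 : 0 ≤ |(p.2 : ℝ) - p.1| ^ (1 / 2 - S.κ) := Real.rpow_nonneg (abs_nonneg _) _
    simp only [quotient, norm_smul, norm_inv, Real.norm_eq_abs, abs_of_nonneg h0]
    rw [inv_mul_eq_div]
    apply div_le_of_le_mul₀ h0 (le_max_right _ _)
    exact (hC _ _).trans (mul_le_mul_of_nonneg_right (le_max_left _ _) h0))⟩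
  map_add' f g := by
    ext1
    funext p
    change (|(p.2 : ℝ) - p.1| ^ (1 / 2 - S.κ))⁻¹ • ((f.1 p.2 + g.1 p.2) - (f.1 p.1 + g.1 p.1))
      = (|(p.2 : ℝ) - p.1| ^ (1 / 2 - S.κ))⁻¹ • (f.1 p.2 - f.1 p.1)
        + (|(p.2 : ℝ) - p.1| ^ (1 / 2 - S.κ))⁻¹ • (g.1 p.2 - g.1 p.1)
    rw [← smul_add, add_sub_add_comm]
  map_smul' c f := by
    ext1
    funext p
    change (|(p.2 : ℝ) - p.1| ^ (1 / 2 - S.κ))⁻¹ • (c • f.1 p.2 - c • f.1 p.1)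
      = c • (|(p.2 : ℝ) - p.1| ^ (1 / 2 - S.κ))⁻¹ • (f.1 p.2 - f.1 p.1)
    rw [← smul_sub, smul_comm]

theorem toLp_injective : Function.Injective (toLp S) := by
  intro f g h
  apply Subtype.ext
  funext t
  by_cases ht : t = 0
  · rw [ht, f.2.1, g.2.1]
  have h1 : f.quotient (0, t) = g.quotient (0, t) := congrFun (congrArg Subtype.val h) (0, t)
  have ht' : 0 < (t : ℝ) := lt_of_le_of_ne t.2.1 fun h => ht (Subtype.ext h.symm)
  have h2 : (|(t : ℝ) - (0 : unitInterval)| ^ (1 / 2 - S.κ))⁻¹ ≠ 0 := by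
    apply inv_ne_zero
    apply (Real.rpow_pos_of_pos _ _).ne'
    simpa using ht'.ne'
  have h3 := (smul_right_injective _ h2) h1
  simpa [f.2.1, g.2.1] using h3

instance : NormedAddCommGroup (HolderPath S) :=
  NormedAddCommGroup.induced _ _ (toLp S) toLp_injective

instance : NormedSpace ℝ (HolderPath S) := NormedSpace.induced ℝ _ _ (toLp S)

end HolderPath

namespace Model

/-- The path `M ∈ C ^ α` underlying a model. -/
def path (M : Model S) : HolderPath S :=
  ⟨fun t => WithLp.toLp 2 fun i => M.comp i t, by
    constructor
    · ext i
      obtain ⟨C, hC⟩ := M.bound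
      have := hC 0 i 0 0 NoiseSpec.admissible_zero le_rfl le_rfl zero_le_one
      rw [sub_self, Real.zero_rpow (NoiseSpec.hom_pos _).ne', mul_zero] at this
      simpa [comp] using this
    · obtain ⟨C, hC⟩ := M.bound
      have key : ∀ i s t, 0 ≤ s → s ≤ t → t ≤ 1 →
          |M.comp i t - M.comp i s| ≤ C * |t - s| ^ (1 / 2 - S.κ) := by
        intro i s t hs hst ht
        have h1 := M.chen 0 i 0 s t NoiseSpec.admissible_zero le_rfl hs hst ht
        have h2 : Finset.Iic (0 : Fin S.factors → ℕ) = {0} := by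
          ext j; simp
        rw [h2, Finset.sum_singleton] at h1
        simp only [NoiseSpec.coeff, Pi.zero_apply, Nat.choose_self, Nat.cast_one, Nat.sub_self,
          pow_zero, mul_one, Finset.prod_const_one, one_mul] at h1
        have h3 := hC 0 i s t NoiseSpec.admissible_zero hs hst ht
        rw [comp, comp, h1, add_sub_cancel_left, abs_of_nonneg (sub_nonneg.2 hst)]
        simpa [NoiseSpec.hom] using h3
      refine ⟨∑ _i : Fin m, C, fun s t => ?_⟩
      have h4 : ∀ i, |M.comp i t - M.comp i s| ≤ C * |(t : ℝ) - s| ^ (1 / 2 - S.κ) := by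
        intro i
        rcases le_total (s : ℝ) t with h | h
        · exact key i s t s.2.1 h t.2.2
        · rw [abs_sub_comm, abs_sub_comm (t : ℝ)]
          exact key i t s t.2.1 h s.2.2
      rw [EuclideanSpace.norm_eq, Finset.sum_mul]
      refine le_trans ?_ (Finset.sum_le_sum fun i _ => h4 i)
      refine Real.sqrt_le_iff.2 ⟨Finset.sum_nonneg fun i _ => abs_nonneg _, ?_⟩
      exact Finset.sum_sq_le_sq_sum_of_nonneg fun i _ => abs_nonneg _⟩

/-! ### Translation -/

/-- The `n`-th approximation, with left-point Riemann sums along the uniform partition of `[s, t]`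
into `n` intervals, of the Young integrals in
`∑_{j ≤ k} ∏ₐ (k a choose j a) ∫ₛᵗ ∏ₐ (ĥ a r - ĥ a s) ^ (k a - j a) d (M.iter j i s r)`, that is of
`∫ₛᵗ ∏ₐ (M̂ a r - M̂ a s + ĥ a r - ĥ a s) ^ (k a) dM i r`. -/
def youngSum (h : CameronMartin m) (M : Model S) (k : Fin S.factors → ℕ) (i : Fin m) (s t : ℝ)
    (n : ℕ) : ℝ :=
  ∑ j ∈ Finset.Iic k, ∑ q ∈ Finset.range n,
    S.coeff (fun a => h.hat S a (s + (t - s) * (q / n)) - h.hat S a s) k j *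
      (M.iter j i s (s + (t - s) * ((q + 1) / n)) - M.iter j i s (s + (t - s) * (q / n)))

/-- `N` is the translate of the model `M` by the Cameron-Martin path `h`:
`N.iter k i s t = ∫ₛᵗ ∏ₐ (M̂ a r - M̂ a s + ĥ a r - ĥ a s) ^ (k a) d (M i + h i) r`,
where the integrals against `h` are Lebesgue integrals, and those against `M` are Young integrals of
powers of `ĥ` with respect to the iterated integrals that are part of the model `M`. -/
def IsTranslate (h : CameronMartin m) (M N : Model S) : Prop :=
  ∀ k i s t, S.Admissible k → 0 ≤ s → s ≤ t → t ≤ 1 →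
    Tendsto (fun n : ℕ => youngSum h M k i s t n +
        ∫ r in s..t, (∏ a, (M.hat a r - M.hat a s + (h.hat S a r - h.hat S a s)) ^ k a) * h r i)
      atTop (𝓝 (N.iter k i s t))

theorem IsTranslate.unique {h : CameronMartin m} {M N N' : Model S} (hN : IsTranslate h M N)
    (hN' : IsTranslate h M N') : N = N' := by
  ext k i s t
  by_cases hd : S.Admissible k ∧ 0 ≤ s ∧ s ≤ t ∧ t ≤ 1
  · obtain ⟨hk, hs, hst, ht⟩ := hd
    exact tendsto_nhds_unique (hN k i s t hk hs hst ht) (hN' k i s t hk hs hst ht)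
  · rw [N.support k i s t hd, N'.support k i s t hd]

open Classical in
/-- The translation `T_h M`, the unique model `N` with `IsTranslate h M N`. It exists for all `h` and
`M` by Young's theory of integration (`ĥ` has finite `q`-variation and the components of `M` finite
`p`-variation, with `1 / p + 1 / q > 1`), so that the last line is never used. -/
def translate (h : CameronMartin m) (M : Model S) : Model S :=
  if hN : ∃ N, IsTranslate h M N then hN.choose else M

end Model

/-! ### Large deviations and the driving random model -/

section Probability

variable {Ω : Type*} [MeasurableSpace Ω]

/-- The random variables `X η` satisfy, as `η ↓ 0`, a large deviation principle with speed `η ^ 2`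
and good rate function `I`. -/
structure SatisfiesLDP {E : Type*} [TopologicalSpace E] (P : Measure Ω) (X : ℝ → Ω → E)
    (I : E → ℝ≥0∞) : Prop where
  good : ∀ c : ℝ≥0, IsCompact {y | I y ≤ c}
  lower : ∀ O : Set E, IsOpen O → -(⨅ y ∈ O, (I y : EReal)) ≤
    liminf (fun η : ℝ => ((η ^ 2 : ℝ) : EReal) * ENNReal.log (P {ω | X η ω ∈ O})) (𝓝[>] 0)
  upper : ∀ F : Set E, IsClosed F →
    limsup (fun η : ℝ => ((η ^ 2 : ℝ) : EReal) * ENNReal.log (P {ω | X η ω ∈ F})) (𝓝[>] 0) ≤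
      -(⨅ y ∈ F, (I y : EReal))

/-- The rate function of Schilder's theorem in model topology: `‖h‖ ^ 2 / 2` at the canonical lift of
`h ∈ H`, and `∞` at all other models. -/
def schilderRate (S : NoiseSpec m) (M : Model S) : ℝ≥0∞ :=
  ⨅ (h : CameronMartin m) (_ : Model.lift S h = M), ENNReal.ofReal (‖h‖ ^ 2 / 2)

/-- `W` is a random model over an `m`-dimensional standard Brownian motion on `[0, 1]`: the components
of the noise are jointly Gaussian and centred with covariance `E[Wᵢ(s) Wⱼ(t)] = δᵢⱼ min(s, t)`. -/
structure IsBrownianModel (P : Measure Ω) (W : Ω → Model S) : Prop where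
  measurable : Measurable W
  gaussian : ProbabilityTheory.IsGaussianProcess
    (fun (p : Fin m × unitInterval) ω => (W ω).comp p.1 p.2) P
  mean : ∀ (i : Fin m) (t : unitInterval), ∫ ω, (W ω).comp i t ∂P = 0
  cov : ∀ (i j : Fin m) (s t : unitInterval),
    ∫ ω, (W ω).comp i s * (W ω).comp j t ∂P = if i = j then min (s : ℝ) t else 0

/-- The random variable `f` is in `L^{1+}`, the union of the spaces `L^p`, `p > 1`. -/
def MemLOnePlus (P : Measure Ω) (f : Ω → ℝ) : Prop := ∃ p : ℝ≥0∞, 1 < p ∧ MemLp f p P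

end Probability

/-! ### Linear and quadratic functionals of a model, and the Taylor-like expansions -/

/-- `G` is continuous linear: it is a bounded linear functional of the underlying path. -/
def IsContinuousLinear (G : Model S → ℝ) : Prop :=
  ∃ L : HolderPath S →L[ℝ] ℝ, ∀ M, G M = L M.path

/-- `G` is continuous quadratic: it is continuous, bounded on the unit ball `|||M||| ≤ 1`, and
`G (T_k δ_η M) = G (k) + η B (M, k) + η ^ 2 G (M)` for a continuous bilinear map `B`. -/
structure IsContinuousQuadratic (G : Model S → ℝ) : Prop where
  continuous : Continuous G
  bounded : ∃ C, ∀ M : Model S, M.homNorm ≤ 1 → |G M| ≤ C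
  expansion : ∃ B : HolderPath S →L[ℝ] CameronMartin m →L[ℝ] ℝ,
    ∀ (k : CameronMartin m) (M : Model S) (η : ℝ), 0 ≤ η →
      G (Model.translate k (Model.dilate η M)) =
        G (Model.lift S k) + η * B M.path k + η ^ 2 * G M

/-- The map `h ↦ Φ⁰₁(h)` on the Cameron-Martin space, the value at time `1` and `ε = 0`. -/
def terminal (Φ : unitInterval → Model S → C(unitInterval, ℝ)) (h : CameronMartin m) : ℝ :=
  Φ 0 (Model.lift S h) 1

/-- The second order Taylor-like expansion
`Φ⁰₁(T_h δ_η M) = Φ⁰₁(h) + η G₁(h, M) + η² G₂(h, M) + R`, with a continuous linear first and a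
continuous quadratic second coefficient, both jointly continuous in `(h, M)`, and with
`|R| ≤ o(η²) + C η³ |||M|||³` uniformly over bounded `h` and bounded `η |||M|||`. -/
structure HasTaylorExpansion (Φ : unitInterval → Model S → C(unitInterval, ℝ))
    (G₁ G₂ : CameronMartin m → Model S → ℝ) : Prop where
  linear : ∀ h, IsContinuousLinear (G₁ h)
  quadratic : ∀ h, IsContinuousQuadratic (G₂ h)
  continuous₁ : Continuous fun p : CameronMartin m × Model S => G₁ p.1 p.2
  continuous₂ : Continuous fun p : CameronMartin m × Model S => G₂ p.1 p.2
  remainder : ∀ b ρ : ℝ, ∃ C : ℝ, ∃ o : ℝ → ℝ, o =o[𝓝[>] 0] (fun η => η ^ 2) ∧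
    ∀ (h : CameronMartin m) (M : Model S) (η : ℝ), ‖h‖ ≤ b → 0 < η → η ≤ 1 → η * M.homNorm ≤ ρ →
      |Φ 0 (Model.translate h (Model.dilate η M)) 1
          - (terminal Φ h + η * G₁ h M + η ^ 2 * G₂ h M)| ≤ o η + C * η ^ 3 * M.homNorm ^ 3

/-- A rescaling `ε ↦ ε̄` with `ε ≤ ε̄` and `ε̄ → 0` as `ε ↓ 0`. -/
structure IsRescaling (bar : ℝ → ℝ) : Prop where
  le : ∀ ε, 0 < ε → ε ≤ 1 → ε ≤ bar ε
  tendsto : Tendsto bar (𝓝[>] 0) (𝓝 0)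

/-- The second order Taylor-like expansion
`Φ^ε₁(T_h δ_ε̄ M) = Φ⁰₁(h) + ε̄ G₁(h, M) + ε̄² (G₂(h, M) + K₂(h)) + R`, in which `Φ^ε` replaces `Φ⁰`
and the second order coefficient changes by a constant `K₂(h)`, with the same remainder estimate. -/
def HasPerturbedExpansion (bar : ℝ → ℝ) (Φ : unitInterval → Model S → C(unitInterval, ℝ))
    (G₁ G₂ : CameronMartin m → Model S → ℝ) (K₂ : CameronMartin m → ℝ) : Prop :=
  ∀ b ρ : ℝ, ∃ C : ℝ, ∃ o : ℝ → ℝ, o =o[𝓝[>] 0] (fun η => η ^ 2) ∧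
    ∀ (h : CameronMartin m) (M : Model S) (ε : unitInterval), ‖h‖ ≤ b → 0 < ε →
      bar ε * M.homNorm ≤ ρ →
      |Φ ε (Model.translate h (Model.dilate (bar ε) M)) 1
          - (terminal Φ h + bar ε * G₁ h M + bar ε ^ 2 * (G₂ h M + K₂ h))|
        ≤ o (bar ε) + C * bar ε ^ 3 * M.homNorm ^ 3

/-! ### The control problem and the coefficient `Δ₂` -/

/-- The energy `Λ(x) = inf {‖h‖² / 2 : Φ₁(h) = x}`. -/
def energy (Φ : unitInterval → Model S → C(unitInterval, ℝ)) (x : ℝ) : ℝ :=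
  sInf {e | ∃ h : CameronMartin m, terminal Φ h = x ∧ e = ‖h‖ ^ 2 / 2}

/-- `hx` is the unique minimizer of `‖h‖² / 2` among the `h` with `Φ₁(h) = x`. -/
def IsUniqueMinimizer (Φ : unitInterval → Model S → C(unitInterval, ℝ)) (x : ℝ)
    (hx : CameronMartin m) : Prop :=
  terminal Φ hx = x ∧ ∀ h, terminal Φ h = x → h ≠ hx → ‖hx‖ < ‖h‖

/-- The direction `v = DΦ₁(hx) / ‖DΦ₁(hx)‖²`, with `DΦ₁(hx)` identified with an element of `H`. -/
def direction (Φ : unitInterval → Model S → C(unitInterval, ℝ)) (hx : CameronMartin m) :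
    CameronMartin m :=
  (‖gradient (terminal Φ) hx‖ ^ 2)⁻¹ • gradient (terminal Φ) hx

/-- The random model `V = T_{- g₁ v} W`, where `g₁(ω) = G₁(hx, W(ω))`. It enhances the Gaussian process
`W - g₁ v`, the part of the noise that is independent of `g₁`; if `W` is a limit of (renormalised)
canonical lifts of mollified Brownian motion, `V` itself is independent of `g₁`. -/
def gaussianModel {Ω : Type*} (W : Ω → Model S)
    (Φ : unitInterval → Model S → C(unitInterval, ℝ)) (G₁ : CameronMartin m → Model S → ℝ)
    (hx : CameronMartin m) (ω : Ω) : Model S :=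
  Model.translate (-(G₁ hx (W ω)) • direction Φ hx) (W ω)

/-- The functional `Δ₂ = G₂(hx, V) + K₂(hx)` of `V`, in the decomposition
`g₂ = G₂(hx, W) + K₂(hx) = Δ₂ + g₁ Δ₁ + g₁² Δ₀` of the second order coefficient, with
`Δ₁ = B(V, v)` and `Δ₀ = G₂(hx, v)`. -/
def delta₂ {Ω : Type*} (W : Ω → Model S) (Φ : unitInterval → Model S → C(unitInterval, ℝ))
    (G₁ G₂ : CameronMartin m → Model S → ℝ) (K₂ : CameronMartin m → ℝ) (hx : CameronMartin m)
    (ω : Ω) : ℝ :=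
  G₂ hx (gaussianModel W Φ G₁ hx ω) + K₂ hx

end RobustVol

end

open RobustVol

/-!
The quantity in the exponential is a functional of the random model alone. Let `G₂ = G₂ hx`, with
bilinear form `B`, and `λ = Λ'(x)`. The expansion of the quadratic functional with `η = 1` gives
`G₂ (T_k M) = G₂ (lift k) + B (M, k) + G₂ M`, so that `F M = λ G₂ (T_{- G₁(M) v} M)` is an explicit
continuous function of `M`, homogeneous of degree two under dilations, and the random variable in the
exponential is `F (W) + λ K₂`. No continuity of translations is needed; the only translations that
have to be computed are those of canonical lifts, `T_h (lift k) = lift (h + k)`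
(`Model.translate_lift`), by convergence of Riemann-Stieltjes sums.

Since `F` is homogeneous, `P (F (W) ≥ n) = P (F (δ_η W) ≥ 1)` with `η = n ^ (-1/2)`, and the large
deviation principle turns into a statement on the exponential rate of the tail of `F (W)`. The rate
is greater than one if `F (lift h) < ‖h‖² / 2` for all `h ≠ 0`: the maximum of `F` over the compact
set of models of rate at most one is then attained, hence smaller than one. It is at most one if the
inequality fails for some `h ≠ 0`. So `exp (F (W)) ∈ L^{1+}` is equivalent to
`F (lift h) < ‖h‖² / 2` for all `h ≠ 0` (`SatisfiesLDP.memLOnePlus_exp_iff`).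

It remains to compare `F (lift h) = λ G₂ (lift (h - DΦ₁(hx)(h) v))` with the second derivative.
* The Taylor-like expansion restricted to canonical lifts is a second order Taylor expansion of `Φ₁`,
  uniform over bounded base points; the remainder is controlled because goodness of the rate function
  bounds the lifts of the unit ball. A converse of Taylor's theorem
  (`HasUniformTaylor.hasFDerivAt_linearPart`) then shows that `Φ₁` is twice differentiable with
  `DΦ₁(hx) = G₁ hx ∘ lift` and `D²Φ₁(hx)(k, k) = 2 G₂ (lift k)`.
* `hx` minimizes `‖h‖² / 2 - Λ (Φ₁ h)`, which gives `⟪hx, k⟫ = λ DΦ₁(hx)(k)`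
  (`IsUniqueMinimizer.inner_eq`). Hence `ker DΦ₁(hx) ⊆ {hx}^⊥`, with equality if `λ ≠ 0`, and
  `h - DΦ₁(hx)(h) v` is the orthogonal projection of `h` to the kernel.
-/

namespace RobustVol

/-! ### Riemann-Stieltjes sums -/

/-- Left-point Riemann-Stieltjes sums of a continuous function against an absolutely continuous one
converge to the Lebesgue integral against the density. -/
theorem tendsto_sum_leftPoint {g ψ : ℝ → ℝ} {s t : ℝ} (hst : s ≤ t)
    (hg : ContinuousOn g (Icc s t)) (hψ : IntervalIntegrable ψ volume s t) :
    Tendsto (fun n : ℕ => ∑ q ∈ Finset.range n, g (s + (t - s) * (q / n)) *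
        ((∫ r in s..s + (t - s) * ((q + 1) / n), ψ r) - ∫ r in s..s + (t - s) * (q / n), ψ r))
      atTop (𝓝 (∫ r in s..t, g r * ψ r)) := by
  rw [Metric.tendsto_atTop]
  intro ε hε
  set I := ∫ r in s..t, |ψ r| with hI
  have hI0 : 0 ≤ I := intervalIntegral.integral_nonneg hst fun _ _ => abs_nonneg _
  obtain ⟨δ, hδ, hδg⟩ := Metric.uniformContinuousOn_iff.1
    (isCompact_Icc.uniformContinuousOn_of_continuous hg) (ε / (I + 1)) (by positivity)
  obtain ⟨N, hN⟩ := exists_nat_gt ((t - s) / δ)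
  refine ⟨N + 1, fun n hn => ?_⟩
  have hn0 : (0 : ℝ) < n := by exact_mod_cast (by omega : 0 < n)
  have hnN : (N : ℝ) ≤ n := by exact_mod_cast (by omega : N ≤ n)
  have hmesh : (t - s) / n < δ := by
    rw [div_lt_iff₀ hδ] at hN
    rw [div_lt_iff₀ hn0]
    nlinarith
  set p : ℕ → ℝ := fun q => s + (t - s) * (q / n) with hp
  have hp_succ : ∀ q : ℕ, s + (t - s) * (((q : ℝ) + 1) / n) = p (q + 1) := by
    intro q; simp [hp]
  have hp0 : p 0 = s := by simp [hp]
  have hpn : p n = t := by simp [hp, hn0.ne']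
  have hmono : Monotone p := by
    intro a b hab
    have : (a : ℝ) ≤ b := by exact_mod_cast hab
    have hts := sub_nonneg.2 hst
    simp only [hp]
    gcongr
  have hstep : ∀ q, p (q + 1) - p q = (t - s) / n := by
    intro q; simp only [hp]; push_cast; field_simp; ring
  have hmem : ∀ q ≤ n, p q ∈ Icc s t := fun q hq =>
    ⟨hp0 ▸ hmono (Nat.zero_le q), hpn ▸ hmono hq⟩
  have hsub : ∀ a b, a ∈ Icc s t → b ∈ Icc s t → uIcc a b ⊆ uIcc s t := by
    intro a b ha hb
    rw [uIcc_of_le hst]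
    exact uIcc_subset_Icc ha hb
  have hψ' : ∀ a b, a ∈ Icc s t → b ∈ Icc s t → IntervalIntegrable ψ volume a b :=
    fun a b ha hb => hψ.mono_set (hsub a b ha hb)
  have hgψ : IntervalIntegrable (fun r => g r * ψ r) volume s t :=
    hψ.continuousOn_mul (by rwa [uIcc_of_le hst])
  have hgψ' : ∀ a b, a ∈ Icc s t → b ∈ Icc s t →
      IntervalIntegrable (fun r => g r * ψ r) volume a b :=
    fun a b ha hb => hgψ.mono_set (hsub a b ha hb)
  have hleft : s ∈ Icc s t := ⟨le_rfl, hst⟩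
  have e1 : ∫ r in s..t, g r * ψ r
      = ∑ q ∈ Finset.range n, ∫ r in p q..p (q + 1), g r * ψ r := by
    rw [intervalIntegral.sum_integral_adjacent_intervals fun q hq =>
      hgψ' _ _ (hmem q hq.le) (hmem (q + 1) hq), hp0, hpn]
  have e2 : I = ∑ q ∈ Finset.range n, ∫ r in p q..p (q + 1), |ψ r| := by
    rw [intervalIntegral.sum_integral_adjacent_intervals fun q hq =>
      (hψ' _ _ (hmem q hq.le) (hmem (q + 1) hq)).abs, hp0, hpn]
  rw [Real.dist_eq, e1, ← Finset.sum_sub_distrib]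
  have key : ∀ q ∈ Finset.range n,
      |g (s + (t - s) * (q / n)) * ((∫ r in s..s + (t - s) * ((q + 1) / n), ψ r)
          - ∫ r in s..s + (t - s) * (q / n), ψ r) - ∫ r in p q..p (q + 1), g r * ψ r|
        ≤ ε / (I + 1) * ∫ r in p q..p (q + 1), |ψ r| := by
    intro q hq
    have hq' := Finset.mem_range.1 hq
    have m1 := hmem q hq'.le
    have m2 := hmem (q + 1) hq'
    have hle : p q ≤ p (q + 1) := hmono (Nat.le_succ q)
    rw [hp_succ, show s + (t - s) * ((q : ℝ) / n) = p q from rfl,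
      intervalIntegral.integral_interval_sub_left (hψ' _ _ hleft m2) (hψ' _ _ hleft m1),
      ← intervalIntegral.integral_const_mul,
      ← intervalIntegral.integral_sub ((hψ' _ _ m1 m2).const_mul _) (hgψ' _ _ m1 m2),
      ← intervalIntegral.integral_const_mul, ← Real.norm_eq_abs]
    refine intervalIntegral.norm_integral_le_of_norm_le hle
      (Eventually.of_forall fun r hr => ?_) ((hψ' _ _ m1 m2).abs.const_mul _)
    rw [← sub_mul, norm_mul, Real.norm_eq_abs (ψ r)]
    refine mul_le_mul_of_nonneg_right ?_ (abs_nonneg _)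
    rw [Real.norm_eq_abs, ← Real.dist_eq, dist_comm]
    refine (hδg r ⟨m1.1.trans hr.1.le, hr.2.trans m2.2⟩ (p q) m1 ?_).le
    rw [Real.dist_eq, abs_of_nonneg (by linarith [hr.1])]
    linarith [hr.2, hstep q]
  calc _ ≤ ∑ q ∈ Finset.range n, ε / (I + 1) * ∫ r in p q..p (q + 1), |ψ r| :=
        (Finset.abs_sum_le_sum_abs _ _).trans (Finset.sum_le_sum key)
    _ = ε / (I + 1) * I := by rw [← Finset.mul_sum, ← e2]
    _ < ε := by
        rw [div_mul_eq_mul_div, div_lt_iff₀ (by positivity)]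
        nlinarith

/-! ### A converse of Taylor's theorem -/

section ConverseTaylor

variable {E : Type*} [NormedAddCommGroup E] [NormedSpace ℝ E] {f : E → ℝ} {a : E → E →L[ℝ] ℝ}
  {B : E → E →L[ℝ] E →L[ℝ] ℝ}

/-- `f` has, with an error that is small uniformly over bounded base points, the second order Taylor
polynomial with linear part `a x` and quadratic part `B x / 2`. -/
def HasUniformTaylor (f : E → ℝ) (a : E → E →L[ℝ] ℝ) (B : E → E →L[ℝ] E →L[ℝ] ℝ) : Prop :=
  ∀ b ε : ℝ, 0 < ε → ∃ δ > 0, ∀ x u, ‖x‖ ≤ b → ‖u‖ ≤ δ →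
    |f (x + u) - (f x + a x u + 1 / 2 * B x u u)| ≤ ε * ‖u‖ ^ 2

theorem HasUniformTaylor.hasFDerivAt (h : HasUniformTaylor f a B) (x : E) :
    HasFDerivAt f (a x) x := by
  rw [hasFDerivAt_iff_isLittleO_nhds_zero, Asymptotics.isLittleO_iff]
  intro c hc
  obtain ⟨δ, hδ, hT⟩ := h ‖x‖ 1 one_pos
  set K := 1 + ‖B x‖ with hK
  have hK0 : 0 < K := by positivity
  filter_upwards [Metric.closedBall_mem_nhds (0 : E) (lt_min hδ (div_pos hc hK0))] with u hu
  rw [mem_closedBall_zero_iff] at hu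
  have h1 := hT x u le_rfl (hu.trans (min_le_left _ _))
  have h2 : ‖u‖ * K ≤ c := (le_div_iff₀ hK0).1 (hu.trans (min_le_right _ _))
  have h3 : |B x u u| ≤ ‖B x‖ * ‖u‖ * ‖u‖ := (B x).le_opNorm₂ u u
  rw [Real.norm_eq_abs]
  have h4 : f (x + u) - f x - a x u
      = (f (x + u) - (f x + a x u + 1 / 2 * B x u u)) + 1 / 2 * B x u u := by ring
  rw [h4]
  refine (abs_add_le _ _).trans ?_
  rw [abs_mul, abs_of_pos (by norm_num : (0 : ℝ) < 1 / 2)]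
  have h5 : ‖u‖ * K * ‖u‖ ≤ c * ‖u‖ := mul_le_mul_of_nonneg_right h2 (norm_nonneg _)
  have h6 : 0 ≤ ‖B x‖ * ‖u‖ * ‖u‖ := by positivity
  rw [hK] at h5
  nlinarith

/-- No continuity of the quadratic part in the base point is needed: expand `f (x + u + w)` about
`x + u` and about `x`. The unknown terms `B (x + u) w w` and `B x w w` are even in `w`, so that they
drop out of the difference between `w` and `-w`. -/
theorem HasUniformTaylor.hasFDerivAt_linearPart (h : HasUniformTaylor f a B)
    (hB : ∀ x u w, B x u w = B x w u) (x : E) : HasFDerivAt a (B x) x := by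
  rw [hasFDerivAt_iff_isLittleO_nhds_zero, Asymptotics.isLittleO_iff]
  intro c hc
  obtain ⟨δ, hδ, hT⟩ := h (‖x‖ + 1) (c / 6) (by positivity)
  filter_upwards [Metric.closedBall_mem_nhds (0 : E) (lt_min (half_pos hδ) one_pos)] with u hu
  rw [mem_closedBall_zero_iff] at hu
  have hu1 := hu.trans (min_le_left _ _)
  have hu2 := hu.trans (min_le_right _ _)
  have hx1 : ‖x‖ ≤ ‖x‖ + 1 := by linarith
  have hxu : ‖x + u‖ ≤ ‖x‖ + 1 := (norm_add_le _ _).trans (by linarith)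
  set T := a (x + u) - a x - B x u with hTdef
  have key : ∀ w, ‖w‖ = ‖u‖ →
      |T w + (1 / 2 * B (x + u) w w - 1 / 2 * B x w w)| ≤ c * ‖u‖ ^ 2 := by
    intro w hw
    have r1 := hT x (u + w) hx1 ((norm_add_le _ _).trans (by linarith))
    have r2 := hT (x + u) w hxu (by linarith)
    have r3 := hT x u hx1 (by linarith)
    have hn : ‖u + w‖ ^ 2 ≤ 4 * ‖u‖ ^ 2 := by
      have : ‖u + w‖ ≤ 2 * ‖u‖ := (norm_add_le _ _).trans (by linarith)
      nlinarith [norm_nonneg (u + w)]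
    have r1' := r1.trans (mul_le_mul_of_nonneg_left hn (by positivity : 0 ≤ c / 6))
    rw [hw] at r2
    rw [← add_assoc] at r1'
    simp only [map_add, add_apply, hB x w u] at r1'
    have e : T w = a (x + u) w - a x w - B x u w := rfl
    rw [e]
    rw [abs_le] at *
    constructor <;> linarith [r1'.1, r1'.2, r2.1, r2.2, r3.1, r3.2]
  have key2 : ∀ w, ‖w‖ = ‖u‖ → |T w| ≤ c * ‖u‖ ^ 2 := by
    intro w hw
    have k1 := key w hw
    have k2 := key (-w) (by rwa [norm_neg])
    simp only [map_neg, neg_apply, neg_neg] at k2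
    rw [abs_le] at *
    constructor <;> linarith [k1.1, k1.2, k2.1, k2.2]
  rcases eq_or_ne u 0 with rfl | hu0
  · simp [hTdef]
  have hupos : 0 < ‖u‖ := norm_pos_iff.2 hu0
  refine ContinuousLinearMap.opNorm_le_of_unit_norm (by positivity) fun w hw => ?_
  have k := key2 (‖u‖ • w) (by rw [norm_smul, hw, norm_norm, mul_one])
  rw [map_smul, smul_eq_mul, abs_mul, abs_of_pos hupos] at k
  rw [Real.norm_eq_abs]
  nlinarith

end ConverseTaylor

/-! ### Exponential moments and tails at the scale of a large deviation principle -/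

section Tails

variable {Ω : Type*} [MeasurableSpace Ω] {P : Measure Ω}

theorem lintegral_exp_lt_top_of_tail [IsFiniteMeasure P] {X : Ω → ℝ} (hX : Measurable X) {p c : ℝ}
    (hp : 0 ≤ p) (hpc : p < c) {N : ℕ}
    (hN : ∀ n : ℕ, N ≤ n → P {ω | (n : ℝ) ≤ X ω} ≤ ENNReal.ofReal (Real.exp (-(c * n)))) :
    ∫⁻ ω, ENNReal.ofReal (Real.exp (p * X ω)) ∂P < ∞ := by
  set T : ℕ → ℝ≥0∞ := fun n => ENNReal.ofReal (Real.exp (p * ((N + n : ℕ) + 1))) with hT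
  set A : ℕ → Set Ω := fun n => {ω | ((N + n : ℕ) : ℝ) ≤ X ω} with hA
  have hAm : ∀ n, MeasurableSet (A n) := fun n => measurableSet_le measurable_const hX
  have hpt : ∀ ω, ENNReal.ofReal (Real.exp (p * X ω))
      ≤ ENNReal.ofReal (Real.exp (p * N)) + ∑' n, (A n).indicator (fun _ => T n) ω := by
    intro ω
    rcases lt_or_ge (X ω) N with h | h
    · refine le_trans (ENNReal.ofReal_le_ofReal (Real.exp_le_exp.2 ?_)) le_self_add
      exact mul_le_mul_of_nonneg_left h.le hp
    · refine le_trans ?_ le_add_self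
      set n := ⌊X ω - N⌋₊ with hn
      have h1 : (n : ℝ) ≤ X ω - N := Nat.floor_le (by linarith)
      have h2 : X ω - N < n + 1 := Nat.lt_floor_add_one _
      have hmem : ω ∈ A n := by
        change ((N + n : ℕ) : ℝ) ≤ X ω
        push_cast; linarith
      refine le_trans ?_ (ENNReal.le_tsum n)
      rw [indicator_of_mem hmem]
      refine ENNReal.ofReal_le_ofReal (Real.exp_le_exp.2 (mul_le_mul_of_nonneg_left ?_ hp))
      push_cast; linarith
  refine (lintegral_mono hpt).trans_lt ?_
  rw [lintegral_add_left measurable_const, lintegral_const,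
    lintegral_tsum fun n => (measurable_const.indicator (hAm n)).aemeasurable]
  refine ENNReal.add_lt_top.2 ⟨ENNReal.mul_lt_top ENNReal.ofReal_lt_top (measure_lt_top _ _), ?_⟩
  have hterm : ∀ n, ∫⁻ ω, (A n).indicator (fun _ => T n) ω ∂P
      ≤ ENNReal.ofReal (Real.exp (p + (p - c) * N) * Real.exp (p - c) ^ n) := by
    intro n
    rw [lintegral_indicator_const (hAm n)]
    refine (mul_le_mul_right (hN (N + n) (by omega)) _).trans ?_
    rw [hT, ← ENNReal.ofReal_mul (Real.exp_pos _).le, ← Real.exp_add, ← Real.exp_nat_mul,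
      ← Real.exp_add]
    refine ENNReal.ofReal_le_ofReal (Real.exp_le_exp.2 (le_of_eq ?_))
    push_cast; ring
  refine (ENNReal.tsum_le_tsum hterm).trans_lt ?_
  have hs : Summable fun n : ℕ => Real.exp (p + (p - c) * N) * Real.exp (p - c) ^ n :=
    (summable_geometric_of_lt_one (Real.exp_pos _).le
      (Real.exp_lt_one_iff.2 (by linarith))).mul_left _
  rw [← ENNReal.ofReal_tsum_of_nonneg (fun n => by positivity) hs]
  exact ENNReal.ofReal_lt_top

theorem lt_ofReal_exp_of_mul_log_lt {y : ℝ≥0∞} {b c : ℝ} (hb : 0 < b)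
    (h : (b : EReal) * ENNReal.log y < c) : y < ENNReal.ofReal (Real.exp (c / b)) := by
  have h1 : ENNReal.log y < ((c / b : ℝ) : EReal) := by
    rw [EReal.coe_div, EReal.lt_div_iff (by exact_mod_cast hb) (EReal.coe_ne_top _), mul_comm]
    exact h
  rw [← EReal.exp_coe, ← ENNReal.exp_log y]
  exact EReal.exp_lt_exp_iff.2 h1

theorem ofReal_exp_lt_of_lt_mul_log {y : ℝ≥0∞} {b c : ℝ} (hb : 0 < b)
    (h : (c : EReal) < (b : EReal) * ENNReal.log y) : ENNReal.ofReal (Real.exp (c / b)) < y := by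
  have h1 : ((c / b : ℝ) : EReal) < ENNReal.log y := by
    rw [EReal.coe_div, EReal.div_lt_iff (by exact_mod_cast hb) (EReal.coe_ne_top _), mul_comm]
    exact h
  rw [← EReal.exp_coe, ← ENNReal.exp_log y]
  exact EReal.exp_lt_exp_iff.2 h1

theorem tendsto_inv_sqrt_natCast :
    Tendsto (fun n : ℕ => (√(n : ℝ))⁻¹) atTop (𝓝[>] 0) := by
  refine tendsto_nhdsWithin_iff.2 ⟨?_, ?_⟩
  · exact tendsto_inv_atTop_zero.comp (Real.tendsto_sqrt_atTop.comp tendsto_natCast_atTop_atTop)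
  · filter_upwards [eventually_gt_atTop 0] with n hn
    exact inv_pos.2 (Real.sqrt_pos.2 (by exact_mod_cast hn))

end Tails

variable {m : ℕ} {S : NoiseSpec m}

/-! ### Linearity of the Cameron-Martin paths and of their Volterra transforms -/

theorem volterra_add {H β C D : ℝ} {f g : ℝ → ℝ} (hH2 : H ≤ 1 / 2) (hβ : 1 / 2 - H < β)
    (f0 : f 0 = 0) (g0 : g 0 = 0)
    (hf : ∀ s t, 0 ≤ s → s ≤ 1 → 0 ≤ t → t ≤ 1 → |f t - f s| ≤ C * |t - s| ^ β)
    (hg : ∀ s t, 0 ≤ s → s ≤ 1 → 0 ≤ t → t ≤ 1 → |g t - g s| ≤ D * |t - s| ^ β)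
    {t : ℝ} (ht0 : 0 ≤ t) (ht1 : t ≤ 1) :
    volterra H (fun r => f r + g r) t = volterra H f t + volterra H g t := by
  rcases hH2.eq_or_lt with rfl | hlt
  · simp [volterra]
  have hfg : ∀ s t, 0 ≤ s → s ≤ 1 → 0 ≤ t → t ≤ 1 →
      |(f t + g t) - (f s + g s)| ≤ (C + D) * |t - s| ^ β := by
    intro s t hs hs1 ht ht1
    rw [add_sub_add_comm, add_mul]
    exact (abs_add_le _ _).trans (add_le_add (hf s t hs hs1 ht ht1) (hg s t hs hs1 ht ht1))
  obtain ⟨i1, e1⟩ := volterra_eq hlt hβ f0 hf ht0 ht1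
  obtain ⟨i2, e2⟩ := volterra_eq hlt hβ g0 hg ht0 ht1
  obtain ⟨-, e3⟩ := volterra_eq (f := fun r => f r + g r) hlt hβ (by simp [f0, g0]) hfg ht0 ht1
  rw [e1, e2, e3]
  have e4 : (fun u => u ^ (H - 3 / 2) * (f t + g t - (f (max (t - u) 0) + g (max (t - u) 0))))
      = fun u => u ^ (H - 3 / 2) * (f t - f (max (t - u) 0))
        + u ^ (H - 3 / 2) * (g t - g (max (t - u) 0)) := by
    funext u; ring
  rw [e4, intervalIntegral.integral_add i1 i2]
  ring

namespace CameronMartin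

theorem ae_uIoc {p : ℝ → Prop} (h : ∀ᵐ r ∂volume.restrict (Icc (0 : ℝ) 1), p r) {s t : ℝ}
    (hs : 0 ≤ s) (hst : s ≤ t) (ht : t ≤ 1) : ∀ᵐ r, r ∈ uIoc s t → p r := by
  rw [ae_restrict_iff' measurableSet_Icc] at h
  filter_upwards [h] with r hr hr'
  rw [uIoc_of_le hst] at hr'
  exact hr ⟨hs.trans hr'.1.le, hr'.2.trans ht⟩

theorem integral_mul_add (h k : CameronMartin m) (i : Fin m) {g : ℝ → ℝ} {s t : ℝ} (hs : 0 ≤ s)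
    (hst : s ≤ t) (ht : t ≤ 1) (hg : ContinuousOn g (Icc s t)) :
    ∫ r in s..t, g r * (h + k : CameronMartin m) r i
      = (∫ r in s..t, g r * h r i) + ∫ r in s..t, g r * k r i := by
  obtain ⟨K, hK⟩ := isCompact_Icc.exists_bound_of_continuousOn hg
  rw [← intervalIntegral.integral_add (h.bound_mul i hs hst ht hg hK).1
    (k.bound_mul i hs hst ht hg hK).1]
  refine intervalIntegral.integral_congr_ae ?_
  filter_upwards [ae_uIoc (Lp.coeFn_add h k) hs hst ht] with r hr hr'
  rw [hr hr', Pi.add_apply, PiLp.add_apply, mul_add]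

theorem integral_mul_smul (c : ℝ) (h : CameronMartin m) (i : Fin m) (g : ℝ → ℝ) {s t : ℝ}
    (hs : 0 ≤ s) (hst : s ≤ t) (ht : t ≤ 1) :
    ∫ r in s..t, g r * (c • h : CameronMartin m) r i = c * ∫ r in s..t, g r * h r i := by
  rw [← intervalIntegral.integral_const_mul]
  refine intervalIntegral.integral_congr_ae ?_
  filter_upwards [ae_uIoc (Lp.coeFn_smul c h) hs hst ht] with r hr hr'
  rw [hr hr', Pi.smul_apply, PiLp.smul_apply, smul_eq_mul]
  ring

theorem path_add (h k : CameronMartin m) (i : Fin m) {t : ℝ} (ht : 0 ≤ t) (ht1 : t ≤ 1) :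
    (h + k).path i t = h.path i t + k.path i t := by
  simpa [path] using integral_mul_add h k i le_rfl ht ht1 (g := fun _ => 1) continuousOn_const

theorem path_smul (c : ℝ) (h : CameronMartin m) (i : Fin m) {t : ℝ} (ht : 0 ≤ t) (ht1 : t ≤ 1) :
    (c • h).path i t = c * h.path i t := by
  simpa [path] using integral_mul_smul c h i (fun _ => 1) le_rfl ht ht1

theorem hat_add (h k : CameronMartin m) (a : Fin S.factors) {t : ℝ} (ht : 0 ≤ t) (ht1 : t ≤ 1) :
    (h + k).hat S a t = h.hat S a t + k.hat S a t := by
  have hα : (1 : ℝ) / 2 - S.κ ≤ 1 / 2 := by linarith [S.κ_pos]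
  rw [hat, volterra_congr _ ht fun r hr hrt => path_add h k (S.driver a) hr (hrt.trans ht1)]
  exact volterra_add (S.hurst_le a) (β := 1 / 2 - S.κ) (by linarith [S.κ_lt_hurst a])
    (by simp [path]) (by simp [path])
    (fun s t hs hs1 ht ht1 => h.path_holder _ hα hs hs1 ht ht1)
    (fun s t hs hs1 ht ht1 => k.path_holder _ hα hs hs1 ht ht1) ht ht1

theorem hat_smul (c : ℝ) (h : CameronMartin m) (a : Fin S.factors) {t : ℝ} (ht : 0 ≤ t)
    (ht1 : t ≤ 1) : (c • h).hat S a t = c * h.hat S a t := by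
  rw [hat, volterra_congr _ ht fun r hr hrt => path_smul c h (S.driver a) hr (hrt.trans ht1),
    volterra_const_mul]
  rfl

/-- A Cameron-Martin path determines its derivative, by Lebesgue's differentiation theorem. -/
theorem ext_path {h k : CameronMartin m}
    (e : ∀ i t, 0 ≤ t → t ≤ 1 → h.path i t = k.path i t) : h = k := by
  have hd : ∀ (h : CameronMartin m) (i : Fin m), ∀ᵐ r, r ∈ Icc (0 : ℝ) 1 →
      HasDerivAt (h.path i) (h r i) r := by
    intro h i
    have := (h.bound_mul i le_rfl zero_le_one le_rfl (g := fun _ => 1) continuousOn_const (K := 1)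
      (by simp)).1.ae_hasDerivAt_integral
    simp only [one_mul, uIcc_of_le (zero_le_one' ℝ)] at this
    filter_upwards [this] with r hr hr'
    exact hr hr' 0 ⟨le_rfl, zero_le_one⟩
  have h0 : ∀ᵐ r : ℝ, r ≠ 0 := by simp [ae_iff, measure_singleton]
  have h1 : ∀ᵐ r : ℝ, r ≠ 1 := by simp [ae_iff, measure_singleton]
  refine Lp.ext ?_
  rw [EventuallyEq, ae_restrict_iff' measurableSet_Icc]
  filter_upwards [ae_all_iff.2 (hd h), ae_all_iff.2 (hd k), h0, h1] with r hr kr r0 r1 hr'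
  ext i
  refine (hr i hr').unique ((kr i hr').congr_of_eventuallyEq ?_)
  filter_upwards [Ioo_mem_nhds (lt_of_le_of_ne hr'.1 r0.symm) (lt_of_le_of_ne hr'.2 r1)] with t ht
  exact e i t ht.1.le ht.2.le

end CameronMartin

namespace Model

/-! ### Canonical lifts, dilations and translations -/

theorem lift_iter (h : CameronMartin m) {k : Fin S.factors → ℕ} {i : Fin m} {s t : ℝ}
    (hk : S.Admissible k) (hs : 0 ≤ s) (hst : s ≤ t) (ht : t ≤ 1) : (lift S h).iter k i s t
      = ∫ r in s..t, (∏ a, (h.hat S a r - h.hat S a s) ^ k a) * h r i :=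
  liftIter_of h hk hs hst ht

theorem lift_comp (h : CameronMartin m) (i : Fin m) {t : ℝ} (ht : 0 ≤ t) (ht1 : t ≤ 1) :
    (lift S h).comp i t = h.path i t := by
  rw [comp, lift_iter h NoiseSpec.admissible_zero le_rfl ht ht1]
  simp [CameronMartin.path]

theorem lift_hat (h : CameronMartin m) (a : Fin S.factors) {t : ℝ} (ht : 0 ≤ t) (ht1 : t ≤ 1) :
    (lift S h).hat a t = h.hat S a t :=
  hatOf_liftIter h a ht ht1

theorem lift_injective : Function.Injective (lift S) := by
  intro h k e
  refine CameronMartin.ext_path fun i t ht ht1 => ?_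
  rw [← lift_comp (S := S) h i ht ht1, ← lift_comp (S := S) k i ht ht1, e]

theorem dilate_one (M : Model S) : dilate 1 M = M := by
  ext k i s t
  simp [dilate]

theorem lift_smul (c : ℝ) (h : CameronMartin m) : lift S (c • h) = dilate c (lift S h) := by
  ext k i s t
  by_cases hd : S.Admissible k ∧ 0 ≤ s ∧ s ≤ t ∧ t ≤ 1
  · obtain ⟨hk, hs, hst, ht⟩ := hd
    change _ = c ^ S.degree k * (lift S h).iter k i s t
    rw [lift_iter _ hk hs hst ht, lift_iter _ hk hs hst ht,
      CameronMartin.integral_mul_smul c h i _ hs hst ht,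
      NoiseSpec.degree, pow_succ', mul_assoc, ← intervalIntegral.integral_const_mul (c ^ _)]
    congr 1
    refine intervalIntegral.integral_congr fun r hr => ?_
    rw [uIcc_of_le hst] at hr
    simp only [CameronMartin.hat_smul c h _ (hs.trans hr.1) (hr.2.trans ht),
      CameronMartin.hat_smul c h _ hs (hst.trans ht), ← mul_sub, mul_pow,
      Finset.prod_mul_distrib, Finset.prod_pow_eq_pow_sum]
    ring
  · rw [(lift S _).support k i s t hd, (dilate c _).support k i s t hd]

theorem isTranslate_lift (h k : CameronMartin m) :
    IsTranslate h (lift S k) (lift S (h + k)) := by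
  intro l i s t hl hs hst ht
  have hs1 : s ≤ 1 := hst.trans ht
  set F : ℝ → ℝ := fun r => ∏ a, (k.hat S a r - k.hat S a s + (h.hat S a r - h.hat S a s)) ^ l a
    with hF
  have hFc : ContinuousOn F (Icc s t) := by
    refine continuousOn_finsetProd _ fun a _ => ContinuousOn.pow ?_ _
    exact (((k.hat_continuousOn S a).mono (Icc_subset_Icc hs ht)).sub continuousOn_const).add
      (((h.hat_continuousOn S a).mono (Icc_subset_Icc hs ht)).sub continuousOn_const)
  have e1 : (lift S (h + k)).iter l i s t
      = (∫ r in s..t, F r * k r i) + ∫ r in s..t, F r * h r i := by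
    rw [lift_iter _ hl hs hst ht, add_comm (∫ r in s..t, F r * k r i),
      ← CameronMartin.integral_mul_add h k i hs hst ht hFc]
    refine intervalIntegral.integral_congr fun r hr => ?_
    rw [uIcc_of_le hst] at hr
    simp only [CameronMartin.hat_add h k _ (hs.trans hr.1) (hr.2.trans ht),
      CameronMartin.hat_add h k _ hs hs1, hF]
    congr 1
    refine Finset.prod_congr rfl fun a _ => ?_
    ring
  have e2 : ∫ r in s..t, (∏ a, ((lift S k).hat a r - (lift S k).hat a s
      + (h.hat S a r - h.hat S a s)) ^ l a) * h r i = ∫ r in s..t, F r * h r i := by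
    refine intervalIntegral.integral_congr fun r hr => ?_
    rw [uIcc_of_le hst] at hr
    simp only [lift_hat k _ (hs.trans hr.1) (hr.2.trans ht), lift_hat k _ hs hs1, hF]
  rw [e1, e2]
  refine Tendsto.add_const _ ?_
  set g : (Fin S.factors → ℕ) → ℝ → ℝ := fun j r =>
    S.coeff (fun a => h.hat S a r - h.hat S a s) l j with hg
  set ψ : (Fin S.factors → ℕ) → ℝ → ℝ := fun j r =>
    (∏ a, (k.hat S a r - k.hat S a s) ^ j a) * k r i with hψ
  have hgc : ∀ j, ContinuousOn (g j) (Icc s t) := fun j =>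
    continuousOn_finsetProd _ fun a _ => continuousOn_const.mul
      ((((h.hat_continuousOn S a).mono (Icc_subset_Icc hs ht)).sub continuousOn_const).pow _)
  have hψi : ∀ j, IntervalIntegrable (ψ j) volume s t := fun j =>
    prod_integrable k _ j i hs hst ht
  -- Expand the product in powers of the increments of `k.hat`.
  have e3 : ∫ r in s..t, F r * k r i = ∑ j ∈ Finset.Iic l, ∫ r in s..t, g j r * ψ j r := by
    rw [← intervalIntegral.integral_finsetSum fun j _ =>
      (hψi j).continuousOn_mul (by rw [uIcc_of_le hst]; exact hgc j)]
    refine intervalIntegral.integral_congr fun r _ => ?_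
    have := NoiseSpec.prod_add_pow (S := S) (fun a => h.hat S a r - h.hat S a s)
      (fun a => k.hat S a r - k.hat S a s) l
    simp only [hF, hg, hψ]
    rw [← Finset.prod_congr rfl fun a _ => by rw [add_comm], this, Finset.sum_mul]
    exact Finset.sum_congr rfl fun j _ => by ring
  rw [e3]
  unfold youngSum
  refine tendsto_finsetSum _ fun j hj => ?_
  refine (tendsto_sum_leftPoint hst (hgc j) (hψi j)).congr fun n => ?_
  refine Finset.sum_congr rfl fun q hq => ?_
  have hqn : (q : ℝ) + 1 ≤ n := by exact_mod_cast Finset.mem_range.1 hq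
  have hn : (0 : ℝ) < n := lt_of_lt_of_le (by positivity) hqn
  have hmem : ∀ y : ℝ, 0 ≤ y → y ≤ n → s ≤ s + (t - s) * (y / n) ∧
      s + (t - s) * (y / n) ≤ 1 := by
    intro y hy hyn
    have h1 : 0 ≤ y / n := by positivity
    have h2 : y / n ≤ 1 := (div_le_one hn).2 hyn
    have h3 := sub_nonneg.2 hst
    constructor <;> nlinarith
  obtain ⟨a1, a2⟩ := hmem q (Nat.cast_nonneg q) (by linarith)
  obtain ⟨b1, b2⟩ := hmem (q + 1) (by positivity) hqn
  rw [lift_iter k (hl.of_le (Finset.mem_Iic.1 hj)) hs a1 a2,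
    lift_iter k (hl.of_le (Finset.mem_Iic.1 hj)) hs b1 b2]

theorem translate_lift (h k : CameronMartin m) :
    translate h (lift S k) = lift S (h + k) := by
  have hN : ∃ N, IsTranslate h (lift S k) N := ⟨_, isTranslate_lift h k⟩
  rw [translate, dif_pos hN]
  exact hN.choose_spec.unique (isTranslate_lift h k)

end Model

/-! ### The underlying path as a function of the model -/

theorem HolderPath.norm_le {f : HolderPath S} {C : ℝ} (hC : 0 ≤ C)
    (hf : ∀ (i : Fin m) (s t : unitInterval), (s : ℝ) < t →
      |f.1 t i - f.1 s i| ≤ C * ((t : ℝ) - s) ^ (1 / 2 - S.κ)) : ‖f‖ ≤ m * C := by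
  change ‖HolderPath.toLp S f‖ ≤ m * C
  refine lp.norm_le_of_forall_le (by positivity) fun p => ?_
  change ‖(|(p.2 : ℝ) - p.1| ^ (1 / 2 - S.κ))⁻¹ • (f.1 p.2 - f.1 p.1)‖ ≤ m * C
  have h0 : 0 ≤ |(p.2 : ℝ) - p.1| ^ (1 / 2 - S.κ) := Real.rpow_nonneg (abs_nonneg _) _
  rw [norm_smul, norm_inv, Real.norm_eq_abs, abs_of_nonneg h0, inv_mul_eq_div]
  refine div_le_of_le_mul₀ h0 (by positivity) ?_
  have h1 : ∀ i, |(f.1 p.2 - f.1 p.1) i| ≤ C * |(p.2 : ℝ) - p.1| ^ (1 / 2 - S.κ) := by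
    intro i
    rw [PiLp.sub_apply]
    rcases lt_trichotomy (p.1 : ℝ) p.2 with h | h | h
    · rw [abs_of_pos (sub_pos.2 h)]
      exact hf i _ _ h
    · rw [Subtype.ext h, sub_self, abs_zero]
      positivity
    · rw [abs_sub_comm, abs_sub_comm (p.2 : ℝ), abs_of_pos (sub_pos.2 h)]
      exact hf i _ _ h
  rw [EuclideanSpace.norm_eq]
  refine Real.sqrt_le_iff.2 ⟨by positivity, ?_⟩
  refine (Finset.sum_sq_le_sq_sum_of_nonneg fun i _ => abs_nonneg _).trans ?_
  refine pow_le_pow_left₀ (Finset.sum_nonneg fun i _ => abs_nonneg _) ?_ 2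
  refine (Finset.sum_le_sum fun i _ => h1 i).trans ?_
  simp [mul_assoc]

namespace Model

theorem comp_sub (M : Model S) (i : Fin m) {s t : ℝ} (hs : 0 ≤ s) (hst : s ≤ t) (ht : t ≤ 1) :
    M.comp i t - M.comp i s = M.iter 0 i s t := by
  have h1 := M.chen 0 i 0 s t NoiseSpec.admissible_zero le_rfl hs hst ht
  have h2 : Finset.Iic (0 : Fin S.factors → ℕ) = {0} := by
    ext j; simp
  rw [h2, Finset.sum_singleton] at h1
  simp only [NoiseSpec.coeff, Pi.zero_apply, Nat.choose_self, Nat.cast_one, Nat.sub_self,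
    pow_zero, mul_one, Finset.prod_const_one, one_mul] at h1
  rw [comp, comp, h1, add_sub_cancel_left]

theorem abs_ratio_sub_le (M N : Model S) (p) : |M.ratio p - N.ratio p| ≤ dist M N := by
  have h1 : dist M N = ‖toLp M - toLp N‖ := dist_eq_norm (toLp M) (toLp N)
  rw [h1]
  exact lp.norm_apply_le_norm ENNReal.top_ne_zero (toLp M - toLp N) p

theorem continuous_path : Continuous (path : Model S → HolderPath S) := by
  refine (LipschitzWith.of_dist_le_mul (K := m) fun M N => ?_).continuous
  rw [dist_eq_norm]
  refine HolderPath.norm_le dist_nonneg fun i s t hst => ?_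
  have hpos : 0 < ((t : ℝ) - s) ^ (1 / 2 - S.κ) := Real.rpow_pos_of_pos (sub_pos.2 hst) _
  have h1 := abs_ratio_sub_le M N (0, i, s, t)
  have h2 : S.hom 0 = 1 / 2 - S.κ := by simp [NoiseSpec.hom]
  simp only [ratio, h2] at h1
  rw [← sub_div, abs_div, abs_of_pos hpos, div_le_iff₀ hpos] at h1
  change |(M.comp i t - N.comp i t) - (M.comp i s - N.comp i s)| ≤ _
  rwa [sub_sub_sub_comm, comp_sub M i s.2.1 hst.le t.2.2, comp_sub N i s.2.1 hst.le t.2.2]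

theorem path_dilate (c : ℝ) (M : Model S) : (dilate c M).path = c • M.path := by
  refine Subtype.ext (funext fun t => ?_)
  ext i
  change c ^ S.degree 0 * M.iter 0 i 0 t = c * M.iter 0 i 0 t
  simp [NoiseSpec.degree]

/-- The continuous linear inclusion of the Cameron-Martin space into the Hölder space. -/
noncomputable def liftPath (S : NoiseSpec m) : CameronMartin m →L[ℝ] HolderPath S :=
  LinearMap.mkContinuous
    { toFun h := (lift S h).path
      map_add' h k := by
        refine Subtype.ext (funext fun t => ?_)
        ext i
        change (lift S (h + k)).comp i t = (lift S h).comp i t + (lift S k).comp i t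
        simp only [lift_comp _ _ t.2.1 t.2.2, CameronMartin.path_add h k i t.2.1 t.2.2]
      map_smul' c h := by rw [lift_smul, path_dilate]; rfl } m fun h => by
    refine HolderPath.norm_le (norm_nonneg h) fun i s t hst => ?_
    change |(lift S h).comp i t - (lift S h).comp i s| ≤ _
    rw [lift_comp h i t.2.1 t.2.2, lift_comp h i s.2.1 s.2.2]
    have := h.path_holder i (α := 1 / 2 - S.κ) (by linarith [S.κ_pos]) s.2.1 s.2.2 t.2.1 t.2.2
    rwa [abs_of_pos (sub_pos.2 hst)] at this

theorem lift_path (h : CameronMartin m) : (lift S h).path = liftPath S h := rfl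

theorem homNorm_lift_le {h : CameronMartin m} {R : ℝ} (hR : dist (lift S h) (lift S 0) ≤ R) :
    (lift S h).homNorm ≤ max R 1 := by
  refine Real.iSup_le (fun p => ?_) (by positivity)
  have h0 : (lift S (0 : CameronMartin m)).ratio p = 0 := by
    rw [← zero_smul ℝ (0 : CameronMartin m), lift_smul]
    simp [ratio, dilate, NoiseSpec.degree]
  have h1 := (abs_ratio_sub_le (lift S h) (lift S 0) p).trans hR
  rw [h0, sub_zero] at h1
  have hd : (1 : ℝ) ≤ S.degree p.1 := by
    exact_mod_cast Nat.le_add_left 1 (∑ a, p.1 a)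
  calc |(lift S h).ratio p| ^ (1 / (S.degree p.1 : ℝ))
      ≤ max R 1 ^ (1 / (S.degree p.1 : ℝ)) :=
        Real.rpow_le_rpow (abs_nonneg _) (h1.trans (le_max_left _ _)) (by positivity)
    _ ≤ max R 1 ^ (1 : ℝ) :=
        Real.rpow_le_rpow_of_exponent_le (le_max_right _ _)
          ((div_le_one (by linarith)).2 hd)
    _ = max R 1 := Real.rpow_one _

end Model

/-! ### Continuous quadratic functionals -/

/-- On canonical lifts a continuous quadratic functional is half its bilinear form `B`, which is
symmetric there. Comparing the expansion for `(M, η)` with that for `(δ_η M, 1)` shows that the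
functional is homogeneous of degree two. -/
theorem IsContinuousQuadratic.exists_bilinear {G : Model S → ℝ} (hG : IsContinuousQuadratic G) :
    ∃ B : HolderPath S →L[ℝ] CameronMartin m →L[ℝ] ℝ,
      (∀ k M, G (Model.translate k M) = G (Model.lift S k) + B M.path k + G M) ∧
      (∀ M η, 0 ≤ η → G (Model.dilate η M) = η ^ 2 * G M) ∧
      (∀ h, G (Model.lift S h) = 1 / 2 * B (Model.liftPath S h) h) ∧
      ∀ h k, B (Model.liftPath S h) k = B (Model.liftPath S k) h := by
  obtain ⟨B, hB⟩ := hG.expansion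
  have h1 : ∀ k M, G (Model.translate k M) = G (Model.lift S k) + B M.path k + G M := by
    intro k M
    simpa [Model.dilate_one] using hB k M 1 zero_le_one
  have h2 : ∀ M η, 0 ≤ η → G (Model.dilate η M) = η ^ 2 * G M := by
    intro M η hη
    have e1 := hB 0 M η hη
    rw [h1, Model.path_dilate] at e1
    simp only [map_zero, mul_zero] at e1
    linarith
  have h3 : ∀ h k, G (Model.lift S (h + k))
      = G (Model.lift S h) + B (Model.liftPath S k) h + G (Model.lift S k) := by
    intro h k
    rw [← Model.translate_lift, h1, Model.lift_path]
  refine ⟨B, h1, h2, fun h => ?_, fun h k => ?_⟩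
  · have e1 := h3 h h
    rw [← two_smul ℝ h, Model.lift_smul, h2 _ _ zero_le_two] at e1
    linarith
  · have e1 := h3 k h
    rw [add_comm, h3 h k] at e1
    linarith

/-! ### The large deviation principle -/

section LDP

variable {Ω : Type*} [MeasurableSpace Ω] {P : Measure Ω}

theorem schilderRate_lift (h : CameronMartin m) :
    schilderRate S (Model.lift S h) = ENNReal.ofReal (‖h‖ ^ 2 / 2) := by
  refine le_antisymm ((iInf_le _ h).trans (iInf_le _ rfl)) (le_iInf₂ fun k hk => ?_)
  rw [Model.lift_injective hk]

theorem exists_lift_of_schilderRate_ne_top {M : Model S} (hM : schilderRate S M ≠ ∞) :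
    ∃ h, Model.lift S h = M := by
  by_contra! hne
  refine hM ?_
  simp only [schilderRate, iInf_eq_top]
  exact fun h hh => absurd hh (hne h)

/-- Goodness of the rate function makes the lift bounded on the unit ball. -/
theorem SatisfiesLDP.exists_homNorm_lift_le {X : ℝ → Ω → Model S}
    (hX : SatisfiesLDP P X (schilderRate S)) :
    ∃ ρ, ∀ h : CameronMartin m, ‖h‖ ≤ 1 → (Model.lift S h).homNorm ≤ ρ := by
  obtain ⟨R, hR⟩ := ((hX.good 1).isBounded.subset_closedBall (Model.lift S 0))
  refine ⟨max R 1, fun h hh => Model.homNorm_lift_le (hR ?_)⟩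
  change schilderRate S (Model.lift S h) ≤ _
  rw [schilderRate_lift, ENNReal.coe_one, ENNReal.ofReal_le_one]
  nlinarith [norm_nonneg h]

/-- The exponential tail of a functional that is homogeneous of degree two has a rate greater than
one if the functional is smaller than the rate function. -/
theorem SatisfiesLDP.tail_upper {W : Ω → Model S}
    (hX : SatisfiesLDP P (fun η ω => Model.dilate η (W ω)) (schilderRate S))
    {F : Model S → ℝ} (hF : Continuous F)
    (hhom : ∀ M η, 0 ≤ η → F (Model.dilate η M) = η ^ 2 * F M)
    (hlt : ∀ h : CameronMartin m, h ≠ 0 → F (Model.lift S h) < ‖h‖ ^ 2 / 2) :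
    ∃ c : ℝ, 1 < c ∧ ∃ N : ℕ, ∀ n : ℕ, N ≤ n →
      P {ω | (n : ℝ) ≤ F (W ω)} ≤ ENNReal.ofReal (Real.exp (-(c * n))) := by
  have hF0 : F (Model.lift S 0) = 0 := by
    rw [← zero_smul ℝ (0 : CameronMartin m), Model.lift_smul, hhom _ _ le_rfl]
    simp
  -- The maximum over the compact set of models of rate at most one is smaller than one.
  obtain ⟨M, hM, hmax⟩ := (hX.good 1).exists_isMaxOn
    ⟨Model.lift S 0, by simp [schilderRate_lift]⟩ hF.continuousOn
  have hM1 : F M < 1 := by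
    have hM' : schilderRate S M ≤ (1 : ℝ≥0) := hM
    obtain ⟨h, rfl⟩ := exists_lift_of_schilderRate_ne_top
      (ne_top_of_le_ne_top ENNReal.coe_ne_top hM')
    rw [schilderRate_lift, ENNReal.coe_one, ENNReal.ofReal_le_one] at hM'
    rcases eq_or_ne h 0 with rfl | h0
    · rw [hF0]; exact one_pos
    · exact (hlt h h0).trans_le hM'
  obtain ⟨σ, hσ1, hσ2⟩ := exists_between (max_lt hM1 one_pos)
  have hσ0 : 0 < σ := (le_max_right _ _).trans_lt hσ1
  have hσM : ∀ h : CameronMartin m, ‖h‖ ^ 2 / 2 ≤ 1 → F (Model.lift S h) ≤ σ := by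
    intro h hh
    refine le_trans (hmax ?_) ((le_max_left _ _).trans hσ1.le)
    change schilderRate S _ ≤ _
    rwa [schilderRate_lift, ENNReal.coe_one, ENNReal.ofReal_le_one]
  -- By homogeneity the rate is at least `1 / σ` where `F` is at least one.
  have hrate : ∀ M ∈ {M | 1 ≤ F M}, ENNReal.ofReal σ⁻¹ ≤ schilderRate S M := by
    intro M hM
    by_cases htop : schilderRate S M = ∞
    · rw [htop]; exact le_top
    obtain ⟨h, rfl⟩ := exists_lift_of_schilderRate_ne_top htop
    rw [schilderRate_lift]
    refine ENNReal.ofReal_le_ofReal ?_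
    have hM' : 1 ≤ F (Model.lift S h) := hM
    have hh : h ≠ 0 := by
      rintro rfl
      rw [hF0] at hM'
      linarith
    have hn : 0 < ‖h‖ := norm_pos_iff.2 hh
    have e1 := hσM ((√2 / ‖h‖) • h) (by
      rw [norm_smul, Real.norm_eq_abs, abs_of_pos (by positivity), div_mul_cancel₀ _ hn.ne',
        Real.sq_sqrt zero_le_two]
      norm_num)
    rw [Model.lift_smul, hhom _ _ (by positivity), div_pow, Real.sq_sqrt zero_le_two] at e1
    rw [inv_le_iff_one_le_mul₀ hσ0]
    calc 1 ≤ F (Model.lift S h) := hM'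
      _ = ‖h‖ ^ 2 / 2 * (2 / ‖h‖ ^ 2 * F (Model.lift S h)) := by field_simp
      _ ≤ ‖h‖ ^ 2 / 2 * σ := by gcongr
  obtain ⟨c, hc1, hc2⟩ := exists_between ((one_lt_inv₀ hσ0).2 hσ2)
  refine ⟨c, hc1, ?_⟩
  have hup := hX.upper {M | 1 ≤ F M} (isClosed_le continuous_const hF)
  have hinf : ((σ⁻¹ : ℝ) : EReal) ≤ ⨅ M ∈ {M | 1 ≤ F M}, (schilderRate S M : EReal) := by
    refine le_iInf₂ fun M hM => ?_
    have := EReal.coe_ennreal_le_coe_ennreal_iff.2 (hrate M hM)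
    rwa [EReal.coe_ennreal_ofReal, max_eq_left (inv_pos.2 hσ0).le] at this
  have hlim : limsup (fun η : ℝ => ((η ^ 2 : ℝ) : EReal) *
      ENNReal.log (P {ω | Model.dilate η (W ω) ∈ {M | 1 ≤ F M}})) (𝓝[>] 0) < ((-c : ℝ) : EReal) := by
    refine (hup.trans (EReal.neg_le_neg_iff.2 hinf)).trans_lt ?_
    rw [← EReal.coe_neg]
    exact EReal.coe_lt_coe_iff.2 (neg_lt_neg hc2)
  have hev := tendsto_inv_sqrt_natCast.eventually (eventually_lt_of_limsup_lt hlim)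
  obtain ⟨N, hN⟩ := eventually_atTop.1 (hev.and (eventually_gt_atTop 0))
  refine ⟨N, fun n hn => ?_⟩
  obtain ⟨h1, h2⟩ := hN n hn
  have hn0 : (0 : ℝ) < n := by exact_mod_cast h2
  have e1 : ((√(n : ℝ))⁻¹) ^ 2 = (n : ℝ)⁻¹ := by rw [inv_pow, Real.sq_sqrt hn0.le]
  rw [e1] at h1
  have h3 := lt_ofReal_exp_of_mul_log_lt (inv_pos.2 hn0) h1
  have e2 : {ω | Model.dilate (√(n : ℝ))⁻¹ (W ω) ∈ {M | 1 ≤ F M}} = {ω | (n : ℝ) ≤ F (W ω)} := by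
    ext ω
    simp only [mem_ofPred_eq]
    rw [hhom _ _ (by positivity), e1, inv_mul_eq_div, one_le_div hn0]
  rw [e2, div_inv_eq_mul, neg_mul] at h3
  exact h3.le

/-- If a functional that is homogeneous of degree two is not smaller than the rate function in some
direction, then its exponential tail has rate at most one. -/
theorem SatisfiesLDP.tail_lower {W : Ω → Model S}
    (hX : SatisfiesLDP P (fun η ω => Model.dilate η (W ω)) (schilderRate S))
    {F : Model S → ℝ} (hF : Continuous F)
    (hhom : ∀ M η, 0 ≤ η → F (Model.dilate η M) = η ^ 2 * F M)
    {h : CameronMartin m} (h0 : h ≠ 0) (hle : ‖h‖ ^ 2 / 2 ≤ F (Model.lift S h))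
    {c : ℝ} (hc : 1 < c) :
    ∃ N : ℕ, ∀ n : ℕ, N ≤ n →
      ENNReal.ofReal (Real.exp (-(c * n))) ≤ P {ω | (n : ℝ) ≤ F (W ω)} := by
  obtain ⟨d, hd1, hd2⟩ := exists_between hc
  have hn : 0 < ‖h‖ := norm_pos_iff.2 h0
  have hFpos : 0 < F (Model.lift S h) := lt_of_lt_of_le (by positivity) hle
  -- Scale the direction so that the value of `F` is `d`.
  set k := √(d / F (Model.lift S h)) • h with hk
  have hsq : √(d / F (Model.lift S h)) ^ 2 = d / F (Model.lift S h) :=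
    Real.sq_sqrt (by positivity)
  have hFk : F (Model.lift S k) = d := by
    rw [hk, Model.lift_smul, hhom _ _ (Real.sqrt_nonneg _), hsq, div_mul_cancel₀ _ hFpos.ne']
  have hnk : ‖k‖ ^ 2 / 2 ≤ d := by
    rw [hk, norm_smul, mul_pow, Real.norm_eq_abs, sq_abs, hsq, mul_div_assoc,
      div_mul_eq_mul_div, div_le_iff₀ hFpos]
    exact mul_le_mul_of_nonneg_left hle (by linarith)
  have hlow := hX.lower {M | 1 < F M} (isOpen_lt continuous_const hF)
  have hinf : (⨅ M ∈ {M | 1 < F M}, (schilderRate S M : EReal)) ≤ (d : EReal) := by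
    have hmem : Model.lift S k ∈ {M | 1 < F M} := by
      change 1 < F _
      rwa [hFk]
    refine (iInf₂_le (Model.lift S k) hmem).trans ?_
    rw [schilderRate_lift, EReal.coe_ennreal_ofReal, max_eq_left (by positivity)]
    exact EReal.coe_le_coe_iff.2 hnk
  have hlim : ((-c : ℝ) : EReal) < liminf (fun η : ℝ => ((η ^ 2 : ℝ) : EReal) *
      ENNReal.log (P {ω | Model.dilate η (W ω) ∈ {M | 1 < F M}})) (𝓝[>] 0) := by
    refine lt_of_lt_of_le ?_ ((EReal.neg_le_neg_iff.2 hinf).trans hlow)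
    rw [← EReal.coe_neg]
    exact EReal.coe_lt_coe_iff.2 (neg_lt_neg hd2)
  have hev := tendsto_inv_sqrt_natCast.eventually (eventually_lt_of_lt_liminf hlim)
  obtain ⟨N, hN⟩ := eventually_atTop.1 (hev.and (eventually_gt_atTop 0))
  refine ⟨N, fun n hn => ?_⟩
  obtain ⟨h1, h2⟩ := hN n hn
  have hn0 : (0 : ℝ) < n := by exact_mod_cast h2
  have e1 : ((√(n : ℝ))⁻¹) ^ 2 = (n : ℝ)⁻¹ := by rw [inv_pow, Real.sq_sqrt hn0.le]
  rw [e1] at h1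
  have h3 := ofReal_exp_lt_of_lt_mul_log (inv_pos.2 hn0) h1
  rw [div_inv_eq_mul, neg_mul] at h3
  refine h3.le.trans (measure_mono fun ω hω => ?_)
  have h4 : 1 < F (Model.dilate (√(n : ℝ))⁻¹ (W ω)) := hω
  rw [hhom _ _ (by positivity), e1, inv_mul_eq_div, one_lt_div hn0] at h4
  exact h4.le

theorem memLp_exp_iff {X : Ω → ℝ} (hX : Measurable X) {p : ℝ} (hp : 0 < p) :
    MemLp (fun ω => Real.exp (X ω)) (ENNReal.ofReal p) P ↔
      ∫⁻ ω, ENNReal.ofReal (Real.exp (p * X ω)) ∂P < ∞ := by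
  have hm : AEStronglyMeasurable (fun ω => Real.exp (X ω)) P :=
    (Real.measurable_exp.comp hX).aestronglyMeasurable
  have hp' : ENNReal.ofReal p ≠ 0 := by simpa using hp
  rw [MemLp, and_iff_right hm,
    eLpNorm_lt_top_iff_lintegral_rpow_enorm_lt_top hp' ENNReal.ofReal_ne_top,
    ENNReal.toReal_ofReal hp.le]
  refine iff_of_eq (congrArg (· < ∞) (lintegral_congr fun ω => ?_))
  rw [Real.enorm_of_nonneg (Real.exp_pos _).le, ENNReal.ofReal_rpow_of_pos (Real.exp_pos _),
    ← Real.exp_mul, mul_comm]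

/-- Integrability of the exponential of a functional that is homogeneous of degree two, to a power
greater than one, means that the functional is smaller than the rate function. -/
theorem SatisfiesLDP.memLOnePlus_exp_iff [IsProbabilityMeasure P] {W : Ω → Model S}
    (hW : Measurable W)
    (hX : SatisfiesLDP P (fun η ω => Model.dilate η (W ω)) (schilderRate S))
    {F : Model S → ℝ} (hF : Continuous F)
    (hhom : ∀ M η, 0 ≤ η → F (Model.dilate η M) = η ^ 2 * F M) (K : ℝ) :
    MemLOnePlus P (fun ω => Real.exp (F (W ω) + K)) ↔
      ∀ h : CameronMartin m, h ≠ 0 → F (Model.lift S h) < ‖h‖ ^ 2 / 2 := by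
  have hFW : Measurable fun ω => F (W ω) := hF.measurable.comp hW
  constructor
  · rintro ⟨q, hq1, hq⟩ h h0
    by_contra! hle
    obtain ⟨p, hp1, hpq⟩ : ∃ p : ℝ, 1 < p ∧ ENNReal.ofReal p ≤ q := by
      obtain ⟨r, hr1, hr2⟩ := ENNReal.lt_iff_exists_real_btwn.1 hq1
      refine ⟨r, ?_, hr2.2.le⟩
      simpa using hr2.1
    obtain ⟨c, hc1, hcp⟩ := exists_between hp1
    obtain ⟨N, hN⟩ := hX.tail_lower hF hhom h0 hle hc1
    have hint := (memLp_exp_iff (hFW.add_const K) (by linarith)).1 (hq.mono_exponent hpq)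
    set A := ∫⁻ ω, ENNReal.ofReal (Real.exp (p * (F (W ω) + K))) ∂P with hA
    -- Markov's inequality bounds the tail by a multiple of `exp (- p n)`.
    have hb : ∀ n : ℕ, N ≤ n → Real.exp ((p - c) * n + p * K) ≤ A.toReal := by
      intro n hn
      have h1 : ENNReal.ofReal (Real.exp (p * (n + K))) * P {ω | (n : ℝ) ≤ F (W ω)} ≤ A := by
        refine le_trans ?_ (mul_meas_ge_le_lintegral
          (f := fun ω => ENNReal.ofReal (Real.exp (p * (F (W ω) + K)))) (by fun_prop)
          (ENNReal.ofReal (Real.exp (p * (n + K)))))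
        refine mul_le_mul_right (measure_mono fun ω hω => ?_) _
        refine ENNReal.ofReal_le_ofReal (Real.exp_le_exp.2 (mul_le_mul_of_nonneg_left ?_
          (by linarith)))
        have hω' : (n : ℝ) ≤ F (W ω) := hω
        linarith
      have h2 := (mul_le_mul_right (hN n hn) _).trans h1
      rw [← ENNReal.ofReal_mul (Real.exp_pos _).le, ← Real.exp_add,
        ENNReal.ofReal_le_iff_le_toReal hint.ne] at h2
      refine le_trans (le_of_eq ?_) h2
      congr 1
      ring
    have ht : Tendsto (fun n : ℕ => Real.exp ((p - c) * n + p * K)) atTop atTop :=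
      Real.tendsto_exp_atTop.comp (tendsto_atTop_add_const_right _ _
        (tendsto_natCast_atTop_atTop.const_mul_atTop (sub_pos.2 hcp)))
    obtain ⟨n, hn1, hn2⟩ := ((eventually_ge_atTop N).and
      (ht.eventually_gt_atTop A.toReal)).exists
    exact absurd (hb n hn1) (not_le.2 hn2)
  · intro hlt
    obtain ⟨c, hc1, N, hN⟩ := hX.tail_upper hF hhom hlt
    obtain ⟨p, hp1, hpc⟩ := exists_between hc1
    refine ⟨ENNReal.ofReal p, by simpa using hp1, ?_⟩
    have h1 := (memLp_exp_iff hFW (by linarith)).2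
      (lintegral_exp_lt_top_of_tail hFW (by linarith) hpc hN)
    simpa [Real.exp_add] using h1.mul_const (Real.exp K)

end LDP

/-! ### Derivatives of the terminal value -/

theorem HasTaylorExpansion.hasUniformTaylor {Φ : unitInterval → Model S → C(unitInterval, ℝ)}
    {G₁ G₂ : CameronMartin m → Model S → ℝ} (hT : HasTaylorExpansion Φ G₁ G₂)
    {ρ : ℝ} (hρ : ∀ h : CameronMartin m, ‖h‖ ≤ 1 → (Model.lift S h).homNorm ≤ ρ)
    {L : CameronMartin m → HolderPath S →L[ℝ] ℝ} (hL : ∀ h M, G₁ h M = L h M.path)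
    {B : CameronMartin m → HolderPath S →L[ℝ] CameronMartin m →L[ℝ] ℝ}
    (hB : ∀ h u, G₂ h (Model.lift S u) = 1 / 2 * B h (Model.liftPath S u) u) :
    HasUniformTaylor (terminal Φ) (fun h => L h ∘L Model.liftPath S)
      (fun h => B h ∘L Model.liftPath S) := by
  intro b ε hε
  obtain ⟨C, o, ho, hrem⟩ := hT.remainder b ρ
  have h0 : ∀ M : Model S, 0 ≤ M.homNorm := fun M =>
    Real.iSup_nonneg fun p => Real.rpow_nonneg (abs_nonneg _) _
  have hρ0 : 0 ≤ ρ := (h0 _).trans (hρ 0 (by simp))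
  obtain ⟨δ, hδ, ho'⟩ := Metric.mem_nhdsWithin_iff.1
    ((Asymptotics.isLittleO_iff.1 ho) (half_pos hε))
  set D := |C| * ρ ^ 3 with hD
  have hD0 : 0 ≤ D := by positivity
  refine ⟨min (δ / 2) (min 1 (ε / 2 / (D + 1))), by positivity, fun x u hx hu => ?_⟩
  rcases eq_or_ne u 0 with rfl | hu0
  · simp
  have hη : 0 < ‖u‖ := norm_pos_iff.2 hu0
  have hu1 := hu.trans (min_le_left _ _)
  have hu2 := hu.trans ((min_le_right _ _).trans (min_le_left _ _))
  have hu3 := hu.trans ((min_le_right _ _).trans (min_le_right _ _))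
  obtain ⟨k, hk1, huk⟩ : ∃ k, ‖k‖ = 1 ∧ u = ‖u‖ • k :=
    ⟨‖u‖⁻¹ • u, by rw [norm_smul, norm_inv, norm_norm, inv_mul_cancel₀ hη.ne'],
      by rw [smul_inv_smul₀ hη.ne']⟩
  have hkρ := hρ k hk1.le
  have hr := hrem x (Model.lift S k) ‖u‖ hx hη hu2
    ((mul_le_of_le_one_left (h0 _) hu2).trans hkρ)
  have e1 : Φ 0 (Model.translate x (Model.dilate ‖u‖ (Model.lift S k))) 1
      = terminal Φ (x + u) := by
    rw [← Model.lift_smul, ← huk, Model.translate_lift, terminal]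
  have e2 : ‖u‖ * G₁ x (Model.lift S k) = (L x ∘L Model.liftPath S) u := by
    conv_rhs => rw [huk]
    rw [map_smul, smul_eq_mul, hL, Model.lift_path]
    rfl
  have e3 : ‖u‖ ^ 2 * G₂ x (Model.lift S k) = 1 / 2 * (B x ∘L Model.liftPath S) u u := by
    conv_rhs => rw [huk]
    rw [hB, map_smul, map_smul, smul_apply, smul_eq_mul, smul_eq_mul,
      ContinuousLinearMap.comp_apply]
    ring
  rw [e1, e2, e3] at hr
  refine hr.trans ?_
  have b1 : o ‖u‖ ≤ ε / 2 * ‖u‖ ^ 2 := by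
    have h1 : ‖u‖ ∈ Metric.ball (0 : ℝ) δ ∩ Ioi 0 :=
      ⟨by rw [Metric.mem_ball, dist_zero_right, norm_norm]; linarith, hη⟩
    have := ho' h1
    simp only [mem_ofPred_eq, Real.norm_eq_abs, abs_pow, abs_norm] at this
    exact (le_abs_self _).trans this
  have b2 : C * ‖u‖ ^ 3 * (Model.lift S k).homNorm ^ 3 ≤ ε / 2 * ‖u‖ ^ 2 := by
    have h1 : (Model.lift S k).homNorm ^ 3 ≤ ρ ^ 3 := pow_le_pow_left₀ (h0 _) hkρ 3
    have h2 : D * ‖u‖ ≤ ε / 2 := by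
      rw [le_div_iff₀ (by positivity)] at hu3
      nlinarith
    calc C * ‖u‖ ^ 3 * (Model.lift S k).homNorm ^ 3 ≤ |C| * ‖u‖ ^ 3 * ρ ^ 3 := by
          have := h0 (Model.lift S k)
          gcongr
          exact le_abs_self C
      _ = D * ‖u‖ * ‖u‖ ^ 2 := by rw [hD]; ring
      _ ≤ _ := by gcongr
  linarith

/-- The Lagrange multiplier rule, with the derivative of the energy as multiplier: as a function of
`h`, `‖h‖ ^ 2 / 2 - Λ (Φ₁ h)` is nonnegative and vanishes at the minimizer. -/
theorem IsUniqueMinimizer.inner_eq {Φ : unitInterval → Model S → C(unitInterval, ℝ)} {x : ℝ}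
    {hx : CameronMartin m} (hmin : IsUniqueMinimizer Φ x hx)
    (hd : DifferentiableAt ℝ (terminal Φ) hx) (hΛ : DifferentiableAt ℝ (energy Φ) x)
    (k : CameronMartin m) :
    inner ℝ hx k = deriv (energy Φ) x * fderiv ℝ (terminal Φ) hx k := by
  have hle : ∀ h : CameronMartin m, energy Φ (terminal Φ h) ≤ ‖h‖ ^ 2 / 2 := by
    intro h
    refine csInf_le ⟨0, ?_⟩ ⟨h, rfl, rfl⟩
    rintro _ ⟨h', -, rfl⟩
    positivity
  have heq : energy Φ (terminal Φ hx) = ‖hx‖ ^ 2 / 2 := by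
    refine le_antisymm (hle hx) (le_csInf ⟨_, hx, rfl, rfl⟩ ?_)
    rintro _ ⟨h, hh, rfl⟩
    rcases eq_or_ne h hx with rfl | hne
    · exact le_rfl
    · have := (hmin.2 h (hh.trans hmin.1) hne).le
      gcongr
  obtain rfl := hmin.1
  have hd1 : HasFDerivAt (fun h : CameronMartin m => ‖h‖ ^ 2 / 2 - energy Φ (terminal Φ h))
      ((2 : ℝ)⁻¹ • (2 • innerSL ℝ hx)
        - deriv (energy Φ) (terminal Φ hx) • fderiv ℝ (terminal Φ) hx) hx := by
    refine HasFDerivAt.sub ?_ (hΛ.hasDerivAt.comp_hasFDerivAt hx hd.hasFDerivAt)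
    simpa [div_eq_inv_mul] using (hasStrictFDerivAt_norm_sq hx).hasFDerivAt.const_mul (2 : ℝ)⁻¹
  have hloc : IsLocalMin (fun h : CameronMartin m => ‖h‖ ^ 2 / 2 - energy Φ (terminal Φ h)) hx :=
    Eventually.of_forall fun h => by
      simp only [heq, sub_self]
      exact sub_nonneg.2 (hle h)
  have := congrArg (fun l : CameronMartin m →L[ℝ] ℝ => l k) (hloc.hasFDerivAt_eq_zero hd1)
  simp at this
  linarith

end RobustVol

/-! ### The criterion for exponential integrability -/

/-- Under a robust representation, a Schilder type large deviation principle for the random model `W`,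
the Taylor-like expansions, and existence of a unique minimizer `hx` with surjective differential, the
form `Λ'(x) D²Φ₁(hx)` is strictly smaller than the identity on `{hx}^⊥` if and only if
`exp (Λ'(x) Δ₂) ∈ L^{1+}`. -/
theorem proposition8p3 {m : ℕ} (S : NoiseSpec m)
    {Ω : Type*} [MeasurableSpace Ω] (P : Measure Ω) [IsProbabilityMeasure P]
    (W : Ω → Model S) (hW : IsBrownianModel P W)
    (hLDP : SatisfiesLDP P (fun η ω => Model.dilate η (W ω)) (schilderRate S))
    (bar : ℝ → ℝ) (hbar : IsRescaling bar)
    (Φ : unitInterval → Model S → C(unitInterval, ℝ))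
    (hΦ : Continuous fun p : unitInterval × Model S => Φ p.1 p.2)
    (G₁ G₂ : CameronMartin m → Model S → ℝ) (K₂ : CameronMartin m → ℝ)
    (hTaylor : HasTaylorExpansion Φ G₁ G₂)
    (hPerturbed : HasPerturbedExpansion bar Φ G₁ G₂ K₂)
    (x : ℝ) (hx : CameronMartin m) (hmin : IsUniqueMinimizer Φ x hx)
    (hsurj : Function.Surjective (fderiv ℝ (terminal Φ) hx))
    (hΛ : DifferentiableAt ℝ (energy Φ) x) :
    (∀ k ∈ (ℝ ∙ hx)ᗮ, k ≠ 0 →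
        deriv (energy Φ) x * fderiv ℝ (fderiv ℝ (terminal Φ)) hx k k < ‖k‖ ^ 2) ↔
      MemLOnePlus P fun ω => Real.exp (deriv (energy Φ) x * delta₂ W Φ G₁ G₂ K₂ hx ω) := by
  obtain ⟨ρ, hρ⟩ := hLDP.exists_homNorm_lift_le
  choose L hL using hTaylor.linear
  choose B hB1 hB2 hB3 hB4 using fun h => (hTaylor.quadratic h).exists_bilinear
  set ι := Model.liftPath S with hι
  have hU := hTaylor.hasUniformTaylor hρ hL hB3
  have hfd : fderiv ℝ (terminal Φ) = fun h => L h ∘L ι :=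
    funext fun h => (hU.hasFDerivAt h).fderiv
  have hfd2 : ∀ k, fderiv ℝ (fderiv ℝ (terminal Φ)) hx k k = B hx (ι k) k := by
    intro k
    rw [hfd, (hU.hasFDerivAt_linearPart (fun h u w => hB4 h u w) hx).fderiv]
    rfl
  have hLagrange := hmin.inner_eq (hU.hasFDerivAt hx).differentiableAt hΛ
  set D := fderiv ℝ (terminal Φ) hx with hD
  set lam := deriv (energy Φ) x with hlam
  have hDG : ∀ h, G₁ hx (Model.lift S h) = D h := by
    intro h
    rw [hL, hD, hfd]
    rfl
  set v := direction Φ hx with hv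
  have hinner : ∀ w, inner ℝ v w = (‖gradient (terminal Φ) hx‖ ^ 2)⁻¹ * D w := by
    intro w
    rw [hv, direction, real_inner_smul_left, inner_gradient_left]
  have hDv : D v = 1 := by
    have hgrad : gradient (terminal Φ) hx ≠ 0 := by
      intro h0
      obtain ⟨u, hu⟩ := hsurj 1
      rw [← inner_gradient_left, h0, inner_zero_left] at hu
      exact zero_ne_one hu
    rw [hv, direction, map_smul, hD, ← inner_gradient_left, real_inner_self_eq_norm_sq,
      smul_eq_mul, inv_mul_cancel₀ (pow_ne_zero 2 (norm_ne_zero_iff.2 hgrad))]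
  set F : Model S → ℝ := fun M => lam * G₂ hx (Model.translate (-(G₁ hx M) • v) M) with hFdef
  -- The expansion of `G₂` replaces the translation by an explicit continuous expression.
  have hFeq : ∀ M, F M = lam * (1 / 2 * G₁ hx M ^ 2 * B hx (ι v) v
      - G₁ hx M * B hx M.path v + G₂ hx M) := by
    intro M
    simp only [hFdef, hB1, hB3, map_smul, smul_apply, smul_eq_mul]
    ring
  have hFc : Continuous F := by
    have h1 : Continuous (G₁ hx) := by
      rw [show G₁ hx = fun M => L hx M.path from funext (hL hx)]
      exact (L hx).continuous.comp Model.continuous_path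
    have h2 : Continuous fun M : Model S => B hx M.path v :=
      ((B hx).continuous.comp Model.continuous_path).clm_apply continuous_const
    rw [show F = _ from funext hFeq]
    exact continuous_const.mul ((((continuous_const.mul (h1.pow 2)).mul continuous_const).sub
      (h1.mul h2)).add (hTaylor.quadratic hx).continuous)
  have hFhom : ∀ M η, 0 ≤ η → F (Model.dilate η M) = η ^ 2 * F M := by
    intro M η hη
    rw [hFeq, hFeq, hB2 hx M η hη, hL, hL, Model.path_dilate]
    simp only [map_smul, smul_apply, smul_eq_mul]
    ring
  have hFlift : ∀ h, F (Model.lift S h)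
      = 1 / 2 * (lam * B hx (ι (-(D h) • v + h)) (-(D h) • v + h)) := by
    intro h
    simp only [hFdef, hDG, Model.translate_lift, hB3]
    ring
  have hexp : (fun ω => Real.exp (lam * delta₂ W Φ G₁ G₂ K₂ hx ω))
      = fun ω => Real.exp (F (W ω) + lam * K₂ hx) := by
    funext ω
    rw [delta₂, mul_add]
    rfl
  rw [hexp, hLDP.memLOnePlus_exp_iff hW.measurable hFc hFhom]
  simp only [hfd2, Submodule.mem_orthogonal_singleton_iff_inner_right]
  constructor
  · intro hform h h0
    have hh : 0 < ‖h‖ := norm_pos_iff.2 h0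
    rw [hFlift]
    set w := -(D h) • v + h with hw
    have hDw : D w = 0 := by
      rw [hw, map_add, map_smul, hDv, smul_eq_mul, mul_one, neg_add_cancel]
    rcases eq_or_ne w 0 with hw0 | hw0
    · rw [hw0]
      simp only [map_zero, mul_zero]
      positivity
    have h1 := hform w (by rw [hLagrange, hDw, mul_zero]) hw0
    -- `w` is the orthogonal projection of `h` to the kernel of the differential.
    have h2 : ‖w‖ ^ 2 ≤ ‖h‖ ^ 2 := by
      have e : h = D h • v + w := by rw [hw]; module
      have hnorm := norm_add_sq_real (D h • v) w
      rw [← e, real_inner_smul_left, hinner, hDw, mul_zero, mul_zero, mul_zero, add_zero] at hnorm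
      rw [hnorm]
      exact le_add_of_nonneg_left (sq_nonneg _)
    linarith
  · intro hlt k hk k0
    have hkpos : 0 < ‖k‖ := norm_pos_iff.2 k0
    rcases eq_or_ne lam 0 with hlam0 | hlam0
    · rw [hlam0, zero_mul]
      positivity
    have hDk : D k = 0 := by
      rw [hLagrange] at hk
      exact (mul_eq_zero.1 hk).resolve_left hlam0
    have h1 := hlt k k0
    rw [hFlift, hDk, neg_zero, zero_smul, zero_add] at h1
    linarith
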